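/- Let $S$ be a subring of $\mathbb{R}$ and let $G$ be a subgroup of the group of positive units of $S$. For $a<b$ in $S$ let $\mathrm{PL}_{S,G}([a,b])$ be the group, under composition, of orientation-preserving piecewise linear homeomorphisms of $[a,b]$ with finitely many breakpoints, all of them in $S$, and with all slopes in $G$. Write $\mathrm{PL}_2=\mathrm{PL}_{\mathbb{Z}[1/2],\langle 2\rangle}$, and let $F=\mathrm{PL}_2([0,1])$ be Thompson's group. For $z\in \mathrm{PL}_{S,G}([a,b])$ let $D(z)=\{t\in[a,b] : z(t)=t\}$, and let $\partial_S D(z)$ be the set of points of $S$ in the boundary of $D(z)$ in $[a,b]$. Let $\mathrm{PL}^0_{S,G}([a,b])$ be the set of those $z\in\mathrm{PL}_{S,G}([a,b])$ for which $D(z)$ contains no point of $S$ other than $a$ and $b$. Write $C_\Gamma(z)$ for the centralizer of $z$ in the group $\Gamma$. **(A) Thompson's group.** Let $x\in F$. Then $\partial_{\mathbb{Z}[1/2]}D(x)\cup\{0,1\}$ is a finite set $\{0=\alpha_0<\alpha_1<\dots<\alpha_N=1\}$. Put $J_i=[\alpha_i,\alpha_{i+1}]$. Then $x$ restricts to an element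 $x_i\in\mathrm{PL}_2(J_i)$ for each $i$, and restriction to the intervals $J_i$ is an isomorphism $C_F(x)\cong\prod_{i} C_{\mathrm{PL}_2(J_i)}(x_i)$. If $x_i=\mathrm{id}$, then $C_{\mathrm{PL}_2(J_i)}(x_i)=\mathrm{PL}_2(J_i)$. If $x_i\neq \mathrm{id}$, then $C_{\mathrm{PL}_2(J_i)}(x_i)$ is infinite cyclic, generated by some $h$ with $h^k=x_i$ for a positive integer $k$. If $m$ is the number of $i$ with $x_i=\mathrm{id}$ and $n$ is the number of $i$ with $x_i\ne \mathrm{id}$, then $0\le m\le n+1$ and $$C_F(x)\cong F^m\times\mathbb{Z}^n .$$ **(B) The groups $\mathrm{PL}_{S,G}(J)$.** Let $S$, $G$ be as above and let $J=[a,b]$ with $a<b$ in $S$. 1. If $\mathrm{id}\ne z\in \mathrm{PL}^0_{S,G}(J)$, then $C_{\mathrm{PL}_{S,G}(J)}(z)\cong\mathbb{Z}$, and it is generated by some $h$ with $h^k=z$ for a positive integer $k$. 2. Let $z\in\mathrm{PL}_{S,G}(J)$. Then $\partial_S D(z)\cup\{a,b\}$ is a finite set $\{a=\alpha_0<\dots<\alpha_N=b\}$.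 With $J_i=[\alpha_i,\alpha_{i+1}]$, the map $z$ restricts to an element $z_i\in \mathrm{PL}_{S,G}(J_i)$ for each $i$, and restriction is an isomorphism $C_{\mathrm{PL}_{S,G}(J)}(z)\cong\prod_i C_{\mathrm{PL}_{S,G}(J_i)}(z_i)$. The $i$-th factor is all of $\mathrm{PL}_{S,G}(J_i)$ if $z_i=\mathrm{id}$, and is infinite cyclic, generated by some $h$ with $h^k=z_i$ for a positive integer $k$, if $z_i\ne\mathrm{id}$. In particular $C_{\mathrm{PL}_{S,G}(J)}(z)$ is isomorphic to the direct product of the groups $\mathrm{PL}_{S,G}(J_i)$ over all $i$ with $z_i=\mathrm{id}$ and of one copy of $\mathbb{Z}$ for each $i$ with $z_i\neq\mathrm{id}$. -/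

import Mathlib

/-- `f` is piecewise linear with finitely many breakpoints, all of them in `S`, and all its slopes
are in `G`: there is a finite set `B ⊆ S` such that on every subinterval `[u, v]` whose interior
does not meet `B` the map `f` is affine with slope in `G`. -/
def IsPL (S : Subring ℝ) (G : Subgroup Sˣ) {a b : ℝ} (f : Set.Icc a b → Set.Icc a b) : Prop :=
  ∃ B : Finset ℝ, (∀ p ∈ B, p ∈ S) ∧
    ∀ u v : Set.Icc a b, u < v → (∀ p ∈ B, ¬ ((u : ℝ) < p ∧ p < (v : ℝ))) →
      ∃ c ∈ G, ∀ t : Set.Icc a b, u ≤ t → t ≤ v →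
        (f t : ℝ) = (f u : ℝ) + ((c : S) : ℝ) * ((t : ℝ) - (u : ℝ))

theorem homeo_left_fixed {a b : ℝ} (f : Set.Icc a b ≃ₜ Set.Icc a b) (hf : StrictMono f)
    (h : a ≤ b) : ((f ⟨a, le_refl a, h⟩ : Set.Icc a b) : ℝ) = a := by
  have h1 : (⟨a, le_refl a, h⟩ : Set.Icc a b) ≤ f.symm ⟨a, le_refl a, h⟩ :=
    (f.symm ⟨a, le_refl a, h⟩).2.1
  have h2 := hf.monotone h1
  rw [f.apply_symm_apply] at h2
  exact le_antisymm h2 (f ⟨a, le_refl a, h⟩).2.1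

theorem homeo_symm_strictMono {a b : ℝ} (f : Set.Icc a b ≃ₜ Set.Icc a b) (hf : StrictMono f) :
    StrictMono f.symm := by
  intro s t hst
  rw [← hf.lt_iff_lt, f.apply_symm_apply, f.apply_symm_apply]
  exact hst

/-- A piecewise linear homeomorphism as above maps points of `S` to points of `S`. -/
theorem IsPL.map_mem {S : Subring ℝ} {G : Subgroup Sˣ} {a b : S}
    {f : Set.Icc (a : ℝ) b ≃ₜ Set.Icc (a : ℝ) b} (hf : StrictMono f) (h : IsPL S G f)
    (t : Set.Icc (a : ℝ) b) (ht : (t : ℝ) ∈ S) : (f t : ℝ) ∈ S := by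
  obtain ⟨B, hB, hlin⟩ := h
  induction hn : (B.filter (fun p => p < (t : ℝ))).card using Nat.strong_induction_on
    generalizing t with
  | _ n ih =>
    have hab : (a : ℝ) ≤ b := t.2.1.trans t.2.2
    rcases eq_or_lt_of_le t.2.1 with hat | hat
    · have : t = ⟨a, le_refl _, hab⟩ := Subtype.ext hat.symm
      rw [this, homeo_left_fixed f hf hab]
      exact a.2
    · by_cases hne : (B.filter (fun p => (a : ℝ) < p ∧ p < (t : ℝ))).Nonempty
      · set p := (B.filter (fun p => (a : ℝ) < p ∧ p < (t : ℝ))).max' hne with hp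
        have hpm := Finset.max'_mem _ hne
        rw [← hp, Finset.mem_filter] at hpm
        obtain ⟨hpB, hap, hpt⟩ := hpm
        let u : Set.Icc (a : ℝ) b := ⟨p, hap.le, hpt.le.trans t.2.2⟩
        have hu : (f u : ℝ) ∈ S := by
          refine ih _ ?_ u (hB p hpB) rfl
          rw [← hn]
          apply Finset.card_lt_card
          refine ⟨fun q hq => ?_, fun hsub => ?_⟩
          · rw [Finset.mem_filter] at hq ⊢
            exact ⟨hq.1, lt_trans hq.2 hpt⟩
          · have := hsub (Finset.mem_filter.2 ⟨hpB, hpt⟩)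
            exact lt_irrefl p (Finset.mem_filter.1 this).2
        obtain ⟨c, -, hc⟩ := hlin u t hpt (by
          rintro q hq ⟨h1, h2⟩
          have : q ≤ p := Finset.le_max' _ q
            (Finset.mem_filter.2 ⟨hq, lt_trans hap h1, h2⟩)
          exact absurd h1 (not_lt.2 this))
        rw [hc t hpt.le le_rfl]
        exact S.add_mem hu (S.mul_mem c.val.2 (S.sub_mem ht (hB p hpB)))
      · let u : Set.Icc (a : ℝ) b := ⟨a, le_refl _, hab⟩
        obtain ⟨c, -, hc⟩ := hlin u t hat (by
          rintro q hq ⟨h1, h2⟩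
          exact hne ⟨q, Finset.mem_filter.2 ⟨hq, h1, h2⟩⟩)
        rw [hc t hat.le le_rfl, homeo_left_fixed f hf hab]
        exact S.add_mem a.2 (S.mul_mem c.val.2 (S.sub_mem ht a.2))

theorem IsPL.refl (S : Subring ℝ) (G : Subgroup Sˣ) (a b : ℝ) :
    IsPL S G (Homeomorph.refl (Set.Icc a b)) := by
  refine ⟨∅, by simp, fun u v _ _ => ⟨1, G.one_mem, fun t _ _ => ?_⟩⟩
  simp

theorem IsPL.symm {S : Subring ℝ} {G : Subgroup Sˣ} {a b : S}
    {f : Set.Icc (a : ℝ) b ≃ₜ Set.Icc (a : ℝ) b} (hf : StrictMono f) (h : IsPL S G f) :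
    IsPL S G f.symm := by
  classical
  have hmem := IsPL.map_mem hf h
  obtain ⟨B, hB, hlin⟩ := h
  have hg := homeo_symm_strictMono f hf
  refine ⟨(B.subtype (fun p => p ∈ Set.Icc (a : ℝ) b)).image (fun p => (f p : ℝ)), ?_, ?_⟩
  · intro q hq
    obtain ⟨p, hp, rfl⟩ := Finset.mem_image.1 hq
    exact hmem p (hB p (Finset.mem_subtype.1 hp))
  · intro u v huv hfree
    obtain ⟨c, hcG, hc⟩ := hlin (f.symm u) (f.symm v) (hg huv) (by
      rintro p hp ⟨h1, h2⟩
      let p' : Set.Icc (a : ℝ) b :=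
        ⟨p, (f.symm u).2.1.trans h1.le, h2.le.trans (f.symm v).2.2⟩
      refine hfree (f p') (Finset.mem_image.2 ⟨p', Finset.mem_subtype.2 hp, rfl⟩) ⟨?_, ?_⟩
      · have : f (f.symm u) < f p' := hf h1
        rw [f.apply_symm_apply] at this
        exact this
      · have : f p' < f (f.symm v) := hf h2
        rw [f.apply_symm_apply] at this
        exact this)
    refine ⟨c⁻¹, G.inv_mem hcG, fun t h1 h2 => ?_⟩
    have h3 := hc (f.symm t) (hg.monotone h1) (hg.monotone h2)
    rw [f.apply_symm_apply, f.apply_symm_apply] at h3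
    have h4 : (((c⁻¹ : Sˣ) : S) : ℝ) * ((c : S) : ℝ) = 1 :=
      congrArg (fun s : S => (s : ℝ)) (Units.inv_mul c)
    linear_combination (-(((c⁻¹ : Sˣ) : S) : ℝ)) * h3
      - ((f.symm t : ℝ) - (f.symm u : ℝ)) * h4

theorem IsPL.comp {S : Subring ℝ} {G : Subgroup Sˣ} {a b : S}
    {f g : Set.Icc (a : ℝ) b ≃ₜ Set.Icc (a : ℝ) b} (hg : StrictMono g)
    (hF : IsPL S G f) (hG : IsPL S G g) : IsPL S G (f ∘ g) := by
  classical
  have hmem := IsPL.map_mem (homeo_symm_strictMono g hg) (IsPL.symm hg hG)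
  obtain ⟨B, hB, hlin⟩ := hF
  obtain ⟨B', hB', hlin'⟩ := hG
  refine ⟨B' ∪ (B.subtype (fun p => p ∈ Set.Icc (a : ℝ) b)).image (fun p => (g.symm p : ℝ)),
    ?_, ?_⟩
  · intro q hq
    rcases Finset.mem_union.1 hq with hq | hq
    · exact hB' q hq
    · obtain ⟨p, hp, rfl⟩ := Finset.mem_image.1 hq
      exact hmem p (hB p (Finset.mem_subtype.1 hp))
  · intro u v huv hfree
    obtain ⟨c', hcG', hc'⟩ := hlin' u v huv
      (fun p hp => hfree p (Finset.mem_union_left _ hp))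
    obtain ⟨c, hcG, hc⟩ := hlin (g u) (g v) (hg huv) (by
      rintro p hp ⟨h1, h2⟩
      let p' : Set.Icc (a : ℝ) b := ⟨p, (g u).2.1.trans h1.le, h2.le.trans (g v).2.2⟩
      refine hfree (g.symm p') (Finset.mem_union_right _
        (Finset.mem_image.2 ⟨p', Finset.mem_subtype.2 hp, rfl⟩)) ⟨?_, ?_⟩
      · change u < g.symm p'
        rw [← hg.lt_iff_lt, g.apply_symm_apply]
        exact h1
      · change g.symm p' < v
        rw [← hg.lt_iff_lt, g.apply_symm_apply]
        exact h2)
    refine ⟨c * c', G.mul_mem hcG hcG', fun t h1 h2 => ?_⟩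
    have e1 := hc' t h1 h2
    have e2 := hc (g t) (hg.monotone h1) (hg.monotone h2)
    simp only [Function.comp_apply, Units.val_mul, Subring.coe_mul]
    linear_combination e2 + ((c : S) : ℝ) * e1

/-- The group `PL_{S,G}([a,b])` (composition as product) of orientation-preserving piecewise linear
homeomorphisms of `[a,b]` with finitely many breakpoints, all in `S`, and with slopes in `G`;
the endpoints `a`, `b` are in `S`. -/
def PLSG (S : Subring ℝ) (G : Subgroup Sˣ) (a b : S) :
    Subgroup (Set.Icc (a : ℝ) b ≃ₜ Set.Icc (a : ℝ) b) where
  carrier := {f | StrictMono f ∧ IsPL S G f}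
  one_mem' := ⟨strictMono_id, IsPL.refl S G a b⟩
  mul_mem' := fun {_ _} hf hg => ⟨hf.1.comp hg.1, IsPL.comp hg.1 hf.2 hg.2⟩
  inv_mem' := fun {f} hf => ⟨homeo_symm_strictMono f hf.1, IsPL.symm hf.1 hf.2⟩

/-- The subset `PL⁰_{S,G}([a,b])`: the elements that fix no point of `S` except the endpoints. -/
def PLSG0 (S : Subring ℝ) (G : Subgroup Sˣ) (a b : S) : Set (PLSG S G a b) :=
  {f | ∀ t : Set.Icc (a : ℝ) b, f.1 t = t → (t : ℝ) ∈ S → (t : ℝ) = a ∨ (t : ℝ) = b}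

/-- The fixed-point set `D(f) ⊆ [a,b]`. -/
def fixedSet {S : Subring ℝ} {G : Subgroup Sˣ} {a b : S} (f : PLSG S G a b) :
    Set (Set.Icc (a : ℝ) b) :=
  {t | f.1 t = t}

/-- The points of `S` in the boundary of `D(f)` (taken in `[a,b]`), together with the endpoints
`a` and `b`. -/
def cutPoints {S : Subring ℝ} {G : Subgroup Sˣ} {a b : S} (f : PLSG S G a b) : Set S :=
  {s | s = a ∨ s = b ∨ ∃ t ∈ frontier (fixedSet f), (t : ℝ) = s}

/-- For `[a',b'] ⊆ [a,b]`: the homeomorphism `h` of `[a',b']` is the restriction of the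
homeomorphism `f` of `[a,b]`. -/
def IsRestriction {S : Subring ℝ} {G : Subgroup Sˣ} {a b a' b' : S} (f : PLSG S G a b)
    (h : PLSG S G a' b') : Prop :=
  ∀ (t : Set.Icc (a : ℝ) b) (t' : Set.Icc (a' : ℝ) b'), (t : ℝ) = t' → (f.1 t : ℝ) = h.1 t'

/-- The subgroup `H` is infinite cyclic, generated by a root of `z`. -/
def IsInfiniteCyclicOnRoot {Γ : Type*} [Group Γ] (H : Subgroup Γ) (z : Γ) : Prop :=
  ∃ h : Γ, H = Subgroup.zpowers h ∧ (∀ j : ℕ, 0 < j → h ^ j ≠ 1) ∧ ∃ k : ℕ, 0 < k ∧ h ^ k = z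

/-- The ring `ℤ[1/2]` of dyadic rationals. -/
def dyadic : Subring ℝ := Subring.closure {(1 / 2 : ℝ)}

theorem half_mem_dyadic : (1 / 2 : ℝ) ∈ dyadic := Subring.subset_closure rfl

/-- `2` as a unit of `ℤ[1/2]`. -/
noncomputable def dyadicTwo : dyadicˣ where
  val := 2
  inv := ⟨1 / 2, half_mem_dyadic⟩
  val_inv := by
    apply Subtype.ext
    change (2 : ℝ) * (1 / 2) = 1
    norm_num
  inv_val := by
    apply Subtype.ext
    change (1 / 2 : ℝ) * 2 = 1
    norm_num

/-- `PL₂([a,b])`: breakpoints in `ℤ[1/2]`, slopes integral powers of `2`. -/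
noncomputable abbrev PL2 (a b : dyadic) :
    Subgroup (Set.Icc (a : ℝ) b ≃ₜ Set.Icc (a : ℝ) b) :=
  PLSG dyadic (Subgroup.zpowers dyadicTwo) a b

/-- Thompson's group `F = PL₂([0,1])`. -/
noncomputable abbrev ThompsonF :
    Subgroup (Set.Icc ((0 : dyadic) : ℝ) (1 : dyadic) ≃ₜ Set.Icc ((0 : dyadic) : ℝ) (1 : dyadic)) :=
  PL2 0 1

/-!
Let `z` be a piecewise linear homeomorphism of `[a, b]` and `D` its fixed-point set.

*No fixed points in `S` inside `(a, b)`.* The logarithm of the slope at `a` is a homomorphism from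
the centralizer of `z ≠ 1` to `ℝ`. It is injective (`PLSG.eq_one_of_commute`): if `g` commutes with
`z` and is the identity on `[a, x]` with `x < b` maximal, then `z x = x`, as otherwise `z` or `z⁻¹`
carries the identity beyond `x`; so `x ∉ S` is not a breakpoint of `g`, and `g` is the identity a
little beyond `x`. Its image is discrete (`PLSG.exists_slope_gap`): let `z` have slope `< 1` at `a`
and first fixed point `p > a`, and let `g` commute with `z` and have slope `μ < 1` at `a`. Then `g`
is linear near `a`, and `g⁻¹` is linear near `p` with slope `κ ≤ 1`, on intervals that depend on `z`
only. A power `ψ` of `z` maps some interval near `p`, on which it is affine, to an interval near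
`a`. If `μ` is close to `1`, then `g⁻¹` moves some points of this interval within it, and
`ψ = g ψ g⁻¹` forces `μ κ = 1`, which is impossible. A nontrivial discrete subgroup of `ℝ` is
infinite cyclic.

*The general case.* The boundary of `D` is finite because `z` is piecewise linear, and the
centralizer of `z` permutes the points of `S` in it monotonically, hence fixes them
(`PLSG.apply_eq_of_commute`). So it restricts to the pieces between consecutive such points, and
elements on the pieces glue (`IsPartition.exists_centralizer_mulEquiv`). A piece on which `z` fixes
an interior point of `S` is fixed pointwise, since the interior of `D` can end only at a breakpoint
(`mem_PLSG0_of_ne_one`). On all other pieces the first case applies.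

*Thompson's group.* Two adjacent pieces cannot both be fixed pointwise, which gives `m ≤ n + 1`.
An interval with dyadic endpoints is carried by a dilation to `[0, k]`, and `[0, k + 2]` is carried
to `[0, k + 1]` by halving its last two unit intervals, so that every `PL₂([a, b])` is isomorphic
to `F` (`PL2_mulEquiv_thompsonF`).
-/

/-! ### Local affineness and propagation of the identity -/

section Basic

variable {S : Subring ℝ} {G : Subgroup Sˣ} {a b : S}

theorem exists_gt_forall_not_between (B : Finset ℝ) {x y : ℝ} (h : x < y) :
    ∃ v, x < v ∧ v < y ∧ ∀ p ∈ B, ¬(x < p ∧ p < v) := by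
  have h1 : ∀ᶠ v in nhdsWithin x (Set.Ioi x), ∀ p ∈ B, ¬(x < p ∧ p < v) := by
    rw [Finset.eventually_all]
    intro p _
    by_cases hp : x < p
    · filter_upwards [Ioo_mem_nhdsGT hp] with v hv hh
      exact lt_asymm hh.2 hv.2
    · exact Filter.Eventually.of_forall fun v hh => hp hh.1
  obtain ⟨v, hv, hv2⟩ := (h1.and (Ioo_mem_nhdsGT h)).exists
  exact ⟨v, hv2.1, hv2.2, hv⟩

theorem exists_lt_forall_not_between (B : Finset ℝ) {x y : ℝ} (h : y < x) :
    ∃ u, y < u ∧ u < x ∧ ∀ p ∈ B, ¬(u < p ∧ p < x) := by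
  have h1 : ∀ᶠ v in nhdsWithin x (Set.Iio x), ∀ p ∈ B, ¬(v < p ∧ p < x) := by
    rw [Finset.eventually_all]
    intro p _
    by_cases hp : p < x
    · filter_upwards [Ioo_mem_nhdsLT hp] with v hv hh
      exact lt_asymm hh.1 hv.1
    · exact Filter.Eventually.of_forall fun v hh => hp hh.2
  obtain ⟨v, hv, hv2⟩ := (h1.and (Ioo_mem_nhdsLT h)).exists
  exact ⟨v, hv2.1, hv2.2, hv⟩

/-- A piecewise linear map is affine on some interval to the right of any point other than `b`. -/
theorem PLSG.exists_affine_right (f : PLSG S G a b) (x : Set.Icc (a : ℝ) b) (hx : (x : ℝ) < b) :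
    ∃ v, x < v ∧ ∃ c : ℝ, 0 < c ∧ ∀ t, x ≤ t → t ≤ v →
      (f.1 t : ℝ) = f.1 x + c * ((t : ℝ) - x) := by
  obtain ⟨B, -, hB⟩ := f.2.2
  obtain ⟨v, hv1, hv2, hv⟩ := exists_gt_forall_not_between B hx
  let w : Set.Icc (a : ℝ) b := ⟨v, x.2.1.trans hv1.le, hv2.le⟩
  have hxw : x < w := hv1
  obtain ⟨c, -, hc⟩ := hB x w hxw hv
  refine ⟨w, hxw, c, ?_, hc⟩
  have h2 := hc w hxw.le le_rfl
  have h3 : (f.1 x : ℝ) < f.1 w := f.2.1 hxw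
  have h4 : (0 : ℝ) < w - x := sub_pos.2 hxw
  exact pos_of_mul_pos_left (by linarith) h4.le

/-- A piecewise linear map is affine on some interval to the left of any point other than `a`. -/
theorem PLSG.exists_affine_left (f : PLSG S G a b) (x : Set.Icc (a : ℝ) b) (hx : (a : ℝ) < x) :
    ∃ u, u < x ∧ ∃ c : ℝ, 0 < c ∧ ∀ t, u ≤ t → t ≤ x →
      (f.1 t : ℝ) = f.1 x + c * ((t : ℝ) - x) := by
  obtain ⟨B, -, hB⟩ := f.2.2
  obtain ⟨v, hv1, hv2, hv⟩ := exists_lt_forall_not_between B hx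
  let w : Set.Icc (a : ℝ) b := ⟨v, hv1.le, hv2.le.trans x.2.2⟩
  have hxw : w < x := hv2
  obtain ⟨c, -, hc⟩ := hB w x hxw hv
  have h2 := hc x hxw.le le_rfl
  refine ⟨w, hxw, c, ?_, fun t h1 h3 => by linarith [hc t h1 h3]⟩
  have h3 : (f.1 w : ℝ) < f.1 x := f.2.1 hxw
  have h4 : (0 : ℝ) < x - w := sub_pos.2 hxw
  exact pos_of_mul_pos_left (by linarith) h4.le

/-- A point outside `S` is not a breakpoint. -/
theorem PLSG.exists_affine_of_notMem (f : PLSG S G a b) (x : Set.Icc (a : ℝ) b)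
    (hx : (x : ℝ) ∉ S) :
    ∃ u v, u < x ∧ x < v ∧ ∃ c : ℝ, ∀ t, u ≤ t → t ≤ v →
      (f.1 t : ℝ) = f.1 x + c * ((t : ℝ) - x) := by
  have hax : (a : ℝ) < x := lt_of_le_of_ne x.2.1 fun h =>
    hx (h.subst (motive := fun r => r ∈ S) a.2)
  have hxb : (x : ℝ) < b := lt_of_le_of_ne x.2.2 fun h =>
    hx (h.symm.subst (motive := fun r => r ∈ S) b.2)
  obtain ⟨B, hBS, hB⟩ := f.2.2
  have hxB : (x : ℝ) ∉ B := fun h => hx (hBS _ h)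
  obtain ⟨v, hv1, hv2, hv⟩ := exists_gt_forall_not_between B hxb
  obtain ⟨u, hu1, hu2, hu⟩ := exists_lt_forall_not_between B hax
  let v' : Set.Icc (a : ℝ) b := ⟨v, x.2.1.trans hv1.le, hv2.le⟩
  let u' : Set.Icc (a : ℝ) b := ⟨u, hu1.le, hu2.le.trans x.2.2⟩
  have hxv : x < v' := hv1
  have hux : u' < x := hu2
  obtain ⟨c, -, hc⟩ := hB u' v' (hux.trans hxv) (by
    rintro p hp ⟨h3, h4⟩
    rcases lt_trichotomy p x with h | h | h
    · exact hu p hp ⟨h3, h⟩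
    · exact hxB (h ▸ hp)
    · exact hv p hp ⟨h, h4⟩)
  refine ⟨u', v', hux, hxv, c, fun t h3 h4 => ?_⟩
  linarith [hc t h3 h4, hc x hux.le hxv.le]

theorem PLSG.mul_apply (f g : PLSG S G a b) (t : Set.Icc (a : ℝ) b) :
    (f * g).1 t = f.1 (g.1 t) := rfl

theorem PLSG.one_apply (t : Set.Icc (a : ℝ) b) : (1 : PLSG S G a b).1 t = t := rfl

theorem PLSG.inv_apply_self (f : PLSG S G a b) (t : Set.Icc (a : ℝ) b) :
    (f⁻¹).1 (f.1 t) = t := f.1.symm_apply_apply t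

theorem PLSG.apply_inv_self (f : PLSG S G a b) (t : Set.Icc (a : ℝ) b) :
    f.1 ((f⁻¹).1 t) = t := f.1.apply_symm_apply t

theorem PLSG.ext {f g : PLSG S G a b} (h : ∀ t, f.1 t = g.1 t) : f = g :=
  Subtype.ext (Homeomorph.ext h)

theorem PLSG.commute_apply {f g : PLSG S G a b} (h : Commute f g) (t : Set.Icc (a : ℝ) b) :
    f.1 (g.1 t) = g.1 (f.1 t) := by
  rw [← PLSG.mul_apply, h.eq, PLSG.mul_apply]

theorem PLSG.map_mem (f : PLSG S G a b) (t : Set.Icc (a : ℝ) b) (ht : (t : ℝ) ∈ S) :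
    (f.1 t : ℝ) ∈ S := IsPL.map_mem f.2.1 f.2.2 t ht

theorem PLSG.map_left (f : PLSG S G a b) {t : Set.Icc (a : ℝ) b} (h : (t : ℝ) = a) :
    f.1 t = t := by
  have hab : (a : ℝ) ≤ b := t.2.1.trans t.2.2
  have ht : t = ⟨a, le_rfl, hab⟩ := Subtype.ext h
  rw [ht]
  exact Subtype.ext (homeo_left_fixed f.1 f.2.1 hab)

theorem PLSG.map_right (f : PLSG S G a b) {t : Set.Icc (a : ℝ) b} (h : (t : ℝ) = b) :
    f.1 t = t := by
  have key : ∀ g : PLSG S G a b, g.1 t ≤ t := fun g => by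
    change (g.1 t : ℝ) ≤ t
    rw [h]
    exact (g.1 t).2.2
  refine le_antisymm (key f) ?_
  have := f.2.1.monotone (key f⁻¹)
  rwa [PLSG.apply_inv_self] at this

theorem PLSG.isClosed_fixedSet (f : PLSG S G a b) : IsClosed (fixedSet f) :=
  isClosed_eq f.1.continuous continuous_id

/-- The interior of the fixed-point set ends only at points of `S`: a map that is the identity on
one side of a non-breakpoint is the identity around it. -/
theorem PLSG.mem_interior_fixedSet (f : PLSG S G a b) {x : Set.Icc (a : ℝ) b}
    (hx : (x : ℝ) ∉ S) (hcl : x ∈ closure (interior (fixedSet f))) :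
    x ∈ interior (fixedSet f) := by
  obtain ⟨u, v, hux, hxv, c, hc⟩ := PLSG.exists_affine_of_notMem f x hx
  have hfx : f.1 x = x := closure_minimal interior_subset (PLSG.isClosed_fixedSet f) hcl
  obtain ⟨s, hs1, hs2⟩ := mem_closure_iff.1 hcl (Set.Ioo u v) isOpen_Ioo ⟨hux, hxv⟩
  by_cases hsx : s = x
  · rwa [← hsx]
  · have hfs : f.1 s = s := interior_subset (s := fixedSet f) hs2
    have h1 := hc s hs1.1.le hs1.2.le
    rw [hfs, hfx] at h1
    have h2 : (s : ℝ) - x ≠ 0 := sub_ne_zero.2 fun h => hsx (Subtype.ext h)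
    have h3 : c = 1 := by
      apply mul_right_cancel₀ h2
      linarith
    refine mem_interior.2 ⟨Set.Ioo u v, fun t ht => ?_, isOpen_Ioo, ⟨hux, hxv⟩⟩
    apply Subtype.ext
    rw [hc t ht.1.le ht.2.le, hfx, h3]
    ring

/-- If `g` commutes with `z`, is the identity near `a`, and `z` fixes no point of `S` inside
`(a, b)`, then `g = 1`. Where the interval on which `g` is the identity would stop, at `x`,
either `z` or its inverse carries it across `x`, or `x` is a fixed point of `z`, hence outside `S`
and not a breakpoint of `g`. -/
theorem PLSG.eq_one_of_commute {z g : PLSG S G a b} (hz : z ∈ PLSG0 S G a b) (h : Commute g z)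
    {v : Set.Icc (a : ℝ) b} (hv : (a : ℝ) < v) (hid : ∀ t ≤ v, g.1 t = t) : g = 1 := by
  have hab : (a : ℝ) ≤ b := v.2.1.trans v.2.2
  let a' : Set.Icc (a : ℝ) b := ⟨a, le_rfl, hab⟩
  let b' : Set.Icc (a : ℝ) b := ⟨b, hab, le_rfl⟩
  let s : Set (Set.Icc (a : ℝ) b) := {t | ∀ r ≤ t, g.1 r = r}
  -- if `g` is the identity on `[a, x]` and commutes with `w`, it is the identity on `[a, w x]`
  have carry : ∀ w : PLSG S G a b, Commute g w → ∀ x ∈ s, w.1 x ∈ s := by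
    intro w hw x hx r hr
    have h1 : (w⁻¹).1 r ≤ x := by
      have := (w⁻¹).2.1.monotone hr
      rwa [PLSG.inv_apply_self] at this
    have h2 := hx _ h1
    rw [PLSG.commute_apply hw.inv_right] at h2
    exact (w⁻¹).2.1.injective h2
  have hs : ∀ x ∈ s, x < b' → ∃ y ∈ s, x < y := by
    intro x hx hxb
    rcases lt_or_ge x v with hxv | hxv
    · exact ⟨v, hid, hxv⟩
    · rcases lt_trichotomy (z.1 x) x with hlt | heq | hgt
      · refine ⟨(z⁻¹).1 x, carry _ h.inv_right x hx, ?_⟩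
        have := (z⁻¹).2.1 hlt
        rwa [PLSG.inv_apply_self] at this
      · have hxS : (x : ℝ) ∉ S := by
          intro hxS
          rcases hz x heq hxS with h1 | h1
          · exact absurd (lt_of_lt_of_le hv hxv) (by rw [h1]; exact lt_irrefl _)
          · exact absurd (show (x : ℝ) < b from hxb) (by rw [h1]; exact lt_irrefl _)
        obtain ⟨u, w, hux, hxw, c, hc⟩ := PLSG.exists_affine_of_notMem g x hxS
        have h1 := hc u le_rfl (hux.trans hxw).le
        rw [hx u hux.le, hx x le_rfl] at h1
        have h2 : (u : ℝ) - x ≠ 0 := (sub_neg.2 (show (u : ℝ) < x from hux)).ne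
        have h3 : c = 1 := by
          apply mul_right_cancel₀ h2
          linarith
        refine ⟨w, fun r hr => ?_, hxw⟩
        rcases le_total r x with hrx | hrx
        · exact hx r hrx
        · apply Subtype.ext
          rw [hc r (hux.le.trans hrx) hr, hx x le_rfl, h3]
          ring
      · exact ⟨z.1 x, carry _ h x hx, hgt⟩
  have hb' : b' ∈ s := by
    have hcl : IsClosed {t : Set.Icc (a : ℝ) b | ∀ r, g.1 r ≠ r → t ≤ r} := by
      simp only [Set.ofPred_forall]
      exact isClosed_iInter fun r => isClosed_iInter fun _ => isClosed_Iic
    -- `m` is the largest point with `g` the identity on `[a, m)`; by continuity `m ∈ s`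
    obtain ⟨m, hm, hmax⟩ := hcl.isCompact.exists_isGreatest
      ⟨v, fun r hr => le_of_not_ge fun hle => hr (hid r hle)⟩
    have hmax' : ∀ y ∈ s, y ≤ m := fun y hy =>
      hmax fun r hr => le_of_not_ge fun hle => hr (hy r hle)
    have hms : m ∈ s := by
      have h1 : (Set.Iio m).Nonempty := ⟨a', lt_of_lt_of_le (show a' < v from hv) (hmax' v hid)⟩
      have h2 : Set.Iio m ⊆ fixedSet g := fun r hr => by_contra fun h3 =>
        absurd (hm r h3) (not_le.2 hr)
      have h3 := closure_minimal h2 (PLSG.isClosed_fixedSet g)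
      rw [closure_Iio' h1] at h3
      exact fun r hr => h3 hr
    rcases lt_or_ge m b' with hlt | hge
    · obtain ⟨y, hy, hmy⟩ := hs m hms hlt
      exact absurd (hmax' y hy) (not_le.2 hmy)
    · exact fun r hr => hms r (hr.trans hge)
  exact PLSG.ext fun t => hb' t t.2.2

end Basic

/-! ### The slope at the left endpoint, and criteria for infinite cyclic groups -/

section Slope

variable {S : Subring ℝ} {G : Subgroup Sˣ} {a b : S}

/-- The positive real `c` is the slope of `f` at the left endpoint `a`. -/
def HasLeftEndSlope (f : PLSG S G a b) (c : ℝ) : Prop :=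
  0 < c ∧ ∃ v : Set.Icc (a : ℝ) b, (a : ℝ) < v ∧
    ∀ t ≤ v, (f.1 t : ℝ) = a + c * ((t : ℝ) - a)

theorem HasLeftEndSlope.exists (hab : a < b) (f : PLSG S G a b) : ∃ c, HasLeftEndSlope f c := by
  let a' : Set.Icc (a : ℝ) b := ⟨a, le_rfl, hab.le⟩
  obtain ⟨v, hv, c, hc0, hc⟩ := PLSG.exists_affine_right f a' hab
  refine ⟨c, hc0, v, hv, fun t ht => ?_⟩
  rw [hc t t.2.1 ht, PLSG.map_left f rfl]

theorem HasLeftEndSlope.unique {f : PLSG S G a b} {c d : ℝ} (hc : HasLeftEndSlope f c)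
    (hd : HasLeftEndSlope f d) : c = d := by
  obtain ⟨-, v, hv, hc⟩ := hc
  obtain ⟨-, w, hw, hd⟩ := hd
  have h1 := hc (min v w) (min_le_left _ _)
  rw [hd _ (min_le_right _ _)] at h1
  have h2 : (a : ℝ) < (min v w : Set.Icc (a : ℝ) b) := by
    rcases min_choice v w with h | h <;> rw [h] <;> assumption
  exact (mul_right_cancel₀ (sub_pos.2 h2).ne' (add_left_cancel h1)).symm

theorem HasLeftEndSlope.mul {f g : PLSG S G a b} {c d : ℝ} (hc : HasLeftEndSlope f c)
    (hd : HasLeftEndSlope g d) : HasLeftEndSlope (f * g) (c * d) := by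
  obtain ⟨hc0, v, hv, hc⟩ := hc
  obtain ⟨hd0, w, hw, hd⟩ := hd
  refine ⟨mul_pos hc0 hd0, min w ((g⁻¹).1 v), ?_, fun t ht => ?_⟩
  · have h : (a : ℝ) < (g⁻¹).1 v := by
      let a' : Set.Icc (a : ℝ) b := ⟨a, le_rfl, v.2.1.trans v.2.2⟩
      have := (g⁻¹).2.1 (show a' < v from hv)
      rwa [PLSG.map_left _ rfl] at this
    rcases min_choice w ((g⁻¹).1 v) with h' | h' <;> rw [h'] <;> assumption
  · have h1 : g.1 t ≤ v := by
      have := g.2.1.monotone (ht.trans (min_le_right _ _))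
      rwa [PLSG.apply_inv_self] at this
    rw [PLSG.mul_apply, hc _ h1, hd t (ht.trans (min_le_left _ _))]
    ring

/-- The logarithm of the slope at the left endpoint. -/
noncomputable def logSlope (hab : a < b) (f : PLSG S G a b) : ℝ :=
  Real.log (Classical.choose (HasLeftEndSlope.exists hab f))

theorem hasLeftEndSlope_exp_logSlope (hab : a < b) (f : PLSG S G a b) :
    HasLeftEndSlope f (Real.exp (logSlope hab f)) := by
  have h := Classical.choose_spec (HasLeftEndSlope.exists hab f)
  rw [logSlope, Real.exp_log h.1]
  exact h

theorem logSlope_mul (hab : a < b) (f g : PLSG S G a b) :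
    logSlope hab (f * g) = logSlope hab f + logSlope hab g := by
  have h := (hasLeftEndSlope_exp_logSlope hab (f * g)).unique
    ((hasLeftEndSlope_exp_logSlope hab f).mul (hasLeftEndSlope_exp_logSlope hab g))
  rwa [← Real.exp_add, Real.exp_eq_exp] at h

theorem logSlope_inv (hab : a < b) (f : PLSG S G a b) :
    logSlope hab f⁻¹ = -logSlope hab f := by
  have h2 := logSlope_mul hab f⁻¹ f
  have h3 := logSlope_mul hab 1 (1 : PLSG S G a b)
  rw [inv_mul_cancel] at h2
  rw [mul_one] at h3
  linarith

/-- If a subgroup `H` containing `z ≠ 1` has an injective homomorphism to `ℝ` whose values avoid an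
interval `(0, r)`, then `H` is infinite cyclic, generated by a root of `z`. -/
theorem isInfiniteCyclicOnRoot_of_hom {Γ : Type*} [Group Γ] (H : Subgroup Γ) (L : Γ → ℝ)
    (hmul : ∀ f g, L (f * g) = L f + L g) (hinj : ∀ g ∈ H, L g = 0 → g = 1) {r : ℝ} (hr : 0 < r)
    (hiso : ∀ g ∈ H, 0 < L g → r ≤ L g) {z : Γ} (hz : z ∈ H) (hz1 : z ≠ 1) :
    IsInfiniteCyclicOnRoot H z := by
  let φ : Γ →* Multiplicative ℝ := MonoidHom.mk' (fun g => Multiplicative.ofAdd (L g)) fun f g =>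
    congrArg Multiplicative.ofAdd (hmul f g)
  let A : AddSubgroup ℝ := Subgroup.toAddSubgroup' (H.map φ)
  have hA : ∀ x, x ∈ A ↔ ∃ g ∈ H, L g = x := fun x => Iff.rfl
  have hzpow : ∀ (g : Γ) (n : ℤ), L (g ^ n) = n * L g := fun g n => by
    have h := congrArg Multiplicative.toAdd (map_zpow φ g n)
    rw [toAdd_zpow, zsmul_eq_mul] at h
    exact h
  obtain ⟨b, hb⟩ := AddSubgroup.cyclic_of_isolated_zero (H := A) hr (by
    rw [Set.disjoint_left]
    rintro x hx ⟨h1, h2⟩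
    obtain ⟨g, hg, rfl⟩ := (hA x).1 hx
    exact absurd (hiso g hg h1) (not_le.2 h2))
  rw [← AddSubgroup.zmultiples_eq_closure] at hb
  obtain ⟨h, hh, hLh⟩ := (hA b).1 (by rw [hb]; exact AddSubgroup.mem_zmultiples b)
  have hgen : ∀ g ∈ H, ∃ n : ℤ, h ^ n = g := by
    intro g hg
    obtain ⟨n, hn⟩ := AddSubgroup.mem_zmultiples_iff.1 (hb ▸ (hA _).2 ⟨g, hg, rfl⟩)
    refine ⟨n, ?_⟩
    have h1 := hinj (h ^ n * g⁻¹) (H.mul_mem (H.zpow_mem hh n) (H.inv_mem hg)) (by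
      have h2 := hzpow g (-1)
      rw [zpow_neg_one] at h2
      rw [hmul, hzpow, h2, hLh, ← hn, zsmul_eq_mul]
      push_cast
      ring)
    exact mul_inv_eq_one.1 h1
  have hb0 : L h ≠ 0 := by
    intro h0
    obtain ⟨n, hn⟩ := hgen z hz
    rw [hinj h hh h0, one_zpow] at hn
    exact hz1 hn.symm
  -- every generator qualifies; the sign is chosen so that `z` is a positive power
  have main : ∀ k : Γ, k ∈ H → (∀ g ∈ H, ∃ n : ℤ, k ^ n = g) → L k ≠ 0 →
      (∃ m : ℕ, 0 < m ∧ k ^ m = z) → IsInfiniteCyclicOnRoot H z := by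
    intro k hk hkg hk0 hm
    refine ⟨k, le_antisymm (fun g hg => Subgroup.mem_zpowers_iff.2 (hkg g hg))
      (Subgroup.zpowers_le.2 hk), fun j hj hj1 => ?_, hm⟩
    have h1 := hzpow k j
    have h2 := hzpow k 0
    rw [zpow_natCast, hj1] at h1
    rw [zpow_zero, h1] at h2
    simp at h2
    rcases h2 with h2 | h2
    · exact hj.ne' h2
    · exact hk0 h2
  obtain ⟨n, hn⟩ := hgen z hz
  have hn0 : n ≠ 0 := by
    rintro rfl
    exact hz1 (by rw [← hn, zpow_zero])
  rcases lt_or_gt_of_ne hn0 with hneg | hpos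
  · refine main h⁻¹ (H.inv_mem hh) (fun g hg => ?_) ?_ ⟨n.natAbs, Int.natAbs_pos.2 hn0, ?_⟩
    · obtain ⟨j, hj⟩ := hgen g hg
      exact ⟨-j, by rw [inv_zpow', neg_neg, hj]⟩
    · have h1 := hzpow h (-1)
      rw [zpow_neg_one] at h1
      rw [h1]
      simpa using hb0
    · rw [← hn, ← zpow_natCast, inv_zpow']
      congr 1
      omega
  · refine main h hh hgen hb0 ⟨n.natAbs, Int.natAbs_pos.2 hn0, ?_⟩
    rw [← hn, ← zpow_natCast]
    congr 1
    omega

theorem IsInfiniteCyclicOnRoot.nonempty_mulEquiv {Γ : Type*} [Group Γ] {H : Subgroup Γ} {z : Γ}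
    (h : IsInfiniteCyclicOnRoot H z) : Nonempty (H ≃* Multiplicative ℤ) := by
  obtain ⟨k, rfl, hk, -⟩ := h
  have hk' : ¬IsOfFinOrder k := by
    rw [isOfFinOrder_iff_pow_eq_one]
    rintro ⟨n, hn, h1⟩
    exact hk n hn h1
  have : Infinite (Subgroup.zpowers k) := (infinite_zpowers.2 hk').to_subtype
  exact ⟨intCyclicMulEquiv.symm⟩

end Slope

/-! ### Orbits and linearity near fixed points -/

section Isolation

variable {S : Subring ℝ} {G : Subgroup Sˣ} {a b : S}

theorem isPreconnected_of_ordConnected_Icc {x y : ℝ} {s : Set (Set.Icc x y)}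
    (hs : s.OrdConnected) : IsPreconnected s := by
  rw [← Topology.IsInducing.subtypeVal.isPreconnected_image]
  refine Set.OrdConnected.isPreconnected ⟨?_⟩
  rintro _ ⟨u, hu, rfl⟩ _ ⟨v, hv, rfl⟩ w hw
  exact ⟨⟨w, u.2.1.trans hw.1, hw.2.trans v.2.2⟩, hs.out hu hv ⟨hw.1, hw.2⟩, rfl⟩

/-- Let `d` be an injective coordinate, let `f` be an injective map which is the contraction
`d ↦ c d` for `0 ≤ d ≤ ε`, and let `g` commute with `f`. If `g` is `d ↦ μ d` for small `d`, with
`μ ≤ 1`, then it is so for all `0 ≤ d ≤ ε`, because `g = f⁻ⁿ g fⁿ` and `fⁿ` carries the larger range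
into the smaller one. -/
theorem linear_of_commute_contraction {X : Type*} {d : X → ℝ} (hd : Function.Injective d)
    {f g : X → X} (hf : Function.Injective f) (hfg : ∀ t, f (g t) = g (f t))
    {c ε δ μ : ℝ} (hc0 : 0 < c) (hc1 : c < 1) (hδ : 0 < δ) (hμ0 : 0 < μ) (hμ1 : μ ≤ 1)
    (hfc : ∀ t, 0 ≤ d t → d t ≤ ε → d (f t) = c * d t)
    (hgμ : ∀ t, 0 ≤ d t → d t ≤ δ → d (g t) = μ * d t)
    {t : X} (ht0 : 0 ≤ d t) (htε : d t ≤ ε) (hex : ∃ s, d s = μ * d t) :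
    d (g t) = μ * d t := by
  have iter : ∀ (n : ℕ) (x : X), 0 ≤ d x → d x ≤ ε → d (f^[n] x) = c ^ n * d x := by
    intro n
    induction n with
    | zero => intro x _ _; simp
    | succ n ih =>
      intro x h0 h1
      have h2 := ih x h0 h1
      have h3 : c ^ n ≤ 1 := pow_le_one₀ hc0.le hc1.le
      rw [Function.iterate_succ_apply', hfc, h2, pow_succ]
      · ring
      · rw [h2]; positivity
      · rw [h2]; exact (mul_le_of_le_one_left h0 h3).trans h1
  obtain ⟨s, hs⟩ := hex
  have hs0 : 0 ≤ d s := by rw [hs]; positivity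
  have hsε : d s ≤ ε := by rw [hs]; exact (mul_le_of_le_one_left ht0 hμ1).trans htε
  obtain ⟨n, hn⟩ : ∃ n : ℕ, c ^ n * d t < δ := by
    have h1 : Filter.Tendsto (fun n : ℕ => c ^ n * d t) Filter.atTop (nhds (0 * d t)) :=
      (tendsto_pow_atTop_nhds_zero_of_lt_one hc0.le hc1).mul_const _
    rw [zero_mul] at h1
    exact (h1.eventually_lt_const hδ).exists
  have h2 : d (g (f^[n] t)) = d (f^[n] s) := by
    rw [iter n s hs0 hsε, hgμ, iter n t ht0 htε, hs]
    · ring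
    · rw [iter n t ht0 htε]; positivity
    · rw [iter n t ht0 htε]; exact hn.le
  have hcomm : f^[n] (g t) = g (f^[n] t) :=
    Function.Commute.iterate_left (f := f) (g := g) hfg n t
  have h3 := hd h2
  rw [← hcomm] at h3
  rw [hf.iterate n h3, hs]

theorem PLSG.pow_apply (f : PLSG S G a b) (n : ℕ) (t : Set.Icc (a : ℝ) b) :
    (f ^ n).1 t = f.1^[n] t := by
  induction n with
  | zero => rfl
  | succ n ih => rw [pow_succ', PLSG.mul_apply, ih, Function.iterate_succ_apply']

/-- If `z` moves every point of `(a, p)` to the left, then every orbit in `(a, p)` tends to `a`. -/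
theorem PLSG.exists_pow_apply_le (z : PLSG S G a b) {p : Set.Icc (a : ℝ) b}
    (hz : ∀ t : Set.Icc (a : ℝ) b, (a : ℝ) < t → t < p → z.1 t < t)
    {t w : Set.Icc (a : ℝ) b} (ht : t < p) (hw : (a : ℝ) < w) : ∃ n : ℕ, (z ^ n).1 t ≤ w := by
  have hle : ∀ s, s < p → z.1 s ≤ s := by
    intro s hs
    rcases eq_or_lt_of_le s.2.1 with h | h
    · exact (PLSG.map_left z h.symm).le
    · exact (hz s h hs).le
  let x : ℕ → Set.Icc (a : ℝ) b := fun n => z.1^[n] t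
  have hxp : ∀ n, x n < p := by
    intro n
    induction n with
    | zero => exact ht
    | succ n ih =>
      change z.1^[n + 1] t < p
      rw [Function.iterate_succ_apply']
      exact (hle _ ih).trans_lt ih
  have hanti : Antitone (fun n => (x n : ℝ)) := antitone_nat_of_succ_le fun n => by
    change (z.1^[n + 1] t : ℝ) ≤ z.1^[n] t
    rw [Function.iterate_succ_apply']
    exact hle _ (hxp n)
  have hbdd : BddBelow (Set.range fun n => (x n : ℝ)) := ⟨a, by
    rintro _ ⟨n, rfl⟩
    exact (x n).2.1⟩
  have hlim := tendsto_atTop_ciInf hanti hbdd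
  set l : ℝ := ⨅ n, (x n : ℝ) with hl
  have hlt : l ≤ t := ciInf_le hbdd 0
  let l' : Set.Icc (a : ℝ) b := ⟨l, le_ciInf fun n => (x n).2.1, hlt.trans t.2.2⟩
  have hlim' : Filter.Tendsto x Filter.atTop (nhds l') := tendsto_subtype_rng.2 hlim
  have hfix : z.1 l' = l' := isFixedPt_of_tendsto_iterate hlim' z.1.continuous.continuousAt
  have hla : (a : ℝ) = l := by
    rcases eq_or_lt_of_le l'.2.1 with h | h
    · exact h
    · exact absurd hfix (hz l' h (lt_of_le_of_lt (show l' ≤ t from hlt) ht)).ne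
  obtain ⟨n, hn⟩ := (hlim.eventually_lt_const (lt_of_eq_of_lt hla.symm hw)).exists
  refine ⟨n, ?_⟩
  rw [PLSG.pow_apply]
  exact hn.le

/-- If the slope of `z` at `a` is less than `1`, then `z` moves all points to the left, up to its
first fixed point `p`. -/
theorem PLSG.exists_first_fixed (z : PLSG S G a b) {c : ℝ} (hc1 : c < 1)
    {e : Set.Icc (a : ℝ) b} (hae : (a : ℝ) < e)
    (hze : ∀ t ≤ e, (z.1 t : ℝ) = a + c * ((t : ℝ) - a)) :
    ∃ p, e < p ∧ z.1 p = p ∧ ∀ t : Set.Icc (a : ℝ) b, (a : ℝ) < t → t < p → z.1 t < t := by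
  have hab : (a : ℝ) ≤ b := e.2.1.trans e.2.2
  have hnear : ∀ t : Set.Icc (a : ℝ) b, (a : ℝ) < t → t ≤ e → z.1 t < t := by
    intro t h1 h2
    change (z.1 t : ℝ) < t
    rw [hze t h2]
    nlinarith
  let b' : Set.Icc (a : ℝ) b := ⟨b, hab, le_rfl⟩
  obtain ⟨p, ⟨hp1, hp2⟩, hpmin⟩ := ((PLSG.isClosed_fixedSet z).isCompact.inter_right
    (isClosed_Ici (a := e))).exists_isLeast ⟨b', PLSG.map_right z rfl, e.2.2⟩
  have hp1' : z.1 p = p := hp1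
  have hep : e < p := lt_of_le_of_ne hp2 fun h => (hnear e hae le_rfl).ne (h ▸ hp1')
  refine ⟨p, hep, hp1', fun t hat htp => ?_⟩
  rcases le_total t e with hte | het
  · exact hnear t hat hte
  · by_contra hlt
    rw [not_lt] at hlt
    obtain ⟨s, hs, hs'⟩ := (isPreconnected_of_ordConnected_Icc
      (s := Set.Icc e t) Set.ordConnected_Icc).intermediate_value₂
      (Set.left_mem_Icc.2 het) (Set.right_mem_Icc.2 het) z.1.continuous.continuousOn
      continuous_id.continuousOn (hnear e hae le_rfl).le hlt
    exact absurd (hpmin ⟨hs', hs.1⟩) (not_le.2 (hs.2.trans_lt htp))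

end Isolation

/-! ### Discreteness of slopes in a centralizer -/

section Isolation

variable {S : Subring ℝ} {G : Subgroup Sˣ} {a b : S}

/-- Slopes at `a` less than `1` of elements commuting with `z` stay away from `1`, if `z` has slope
`c < 1` at `a`.

Let `p` be the first fixed point of `z` after `a`. An element `g` commuting with `z`, of slope
`μ < 1` at `a`, is linear on an interval `[a, e]` that depends on `z` only, and `g⁻¹` is linear with
some slope `κ ≤ 1` on an interval `[q, p]` that depends on `z` only. A power `ψ` of `z` maps an
interval `[u, v] ⊆ [q, p)`, on which it is affine, into `[a, e]`. If `μ` is so close to `1` that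
`g⁻¹` maps an initial segment `[u, m]` of `[u, v]` into `[u, v]`, then comparing slopes in
`ψ = g ψ g⁻¹` gives `μ κ = 1`, which is absurd. -/
theorem PLSG.exists_slope_gap (z : PLSG S G a b) {c : ℝ} (hc : HasLeftEndSlope z c) (hc1 : c < 1) :
    ∃ δ : ℝ, 0 < δ ∧ δ < 1 ∧ ∀ g : PLSG S G a b, Commute g z → ∀ μ, HasLeftEndSlope g μ →
      δ < μ → 1 ≤ μ := by
  obtain ⟨hc0, e, hae, hze⟩ := hc
  obtain ⟨p, hep, hzp, hzlt⟩ := PLSG.exists_first_fixed z hc1 hae hze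
  have hap : (a : ℝ) < p := hae.trans hep
  have hab : (a : ℝ) ≤ b := p.2.1.trans p.2.2
  let a' : Set.Icc (a : ℝ) b := ⟨a, le_rfl, hab⟩
  have hzinv : ∀ t : Set.Icc (a : ℝ) b, (a : ℝ) < t → t < p → t < (z⁻¹).1 t := by
    intro t h1 h2
    have := (z⁻¹).2.1 (hzlt t h1 h2)
    rwa [PLSG.inv_apply_self] at this
  have hzinvp : (z⁻¹).1 p = p := by
    conv_lhs => rw [← hzp]
    exact PLSG.inv_apply_self z p
  obtain ⟨q, hqp, hqe, c', hc'0, hc'1, hzq⟩ : ∃ q, q < p ∧ e ≤ q ∧ ∃ c' : ℝ, 0 < c' ∧ c' < 1 ∧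
      ∀ t, q ≤ t → t ≤ p → ((z⁻¹).1 t : ℝ) = p + c' * ((t : ℝ) - p) := by
    obtain ⟨q, hqp, c', hc'0, hq⟩ := PLSG.exists_affine_left z⁻¹ p hap
    rw [hzinvp] at hq
    have h1 : max q e < p := max_lt hqp hep
    have h2 : ((max q e : Set.Icc (a : ℝ) b) : ℝ) < p := h1
    have h3 : ((max q e : Set.Icc (a : ℝ) b) : ℝ) < (z⁻¹).1 (max q e) :=
      hzinv _ (lt_of_lt_of_le hae (le_max_right q e)) h1
    rw [hq _ (le_max_left _ _) h1.le] at h3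
    refine ⟨max q e, h1, le_max_right _ _, c', hc'0, ?_, fun t ht1 ht2 =>
      hq t ((le_max_left _ _).trans ht1) ht2⟩
    by_contra hge
    nlinarith
  obtain ⟨v, hqv, hvp⟩ := exists_between hqp
  obtain ⟨N, hN⟩ := PLSG.exists_pow_apply_le z hzlt hvp hae
  have haq : (a : ℝ) < q := lt_of_lt_of_le hae hqe
  obtain ⟨u, huv, hqu, d, hd0, hd⟩ : ∃ u, u < v ∧ q ≤ u ∧ ∃ d : ℝ, 0 < d ∧ ∀ t, u ≤ t → t ≤ v →
      ((z ^ N).1 t : ℝ) = (z ^ N).1 v + d * ((t : ℝ) - v) := by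
    obtain ⟨u, huv, d, hd0, hd⟩ := PLSG.exists_affine_left (z ^ N) v (haq.trans hqv)
    exact ⟨max u q, max_lt huv hqv, le_max_right _ _, d, hd0, fun t ht1 ht2 =>
      hd t ((le_max_left _ _).trans ht1) ht2⟩
  obtain ⟨m, hum, hmv⟩ := exists_between huv
  have hψm : (a : ℝ) < (z ^ N).1 m := by
    have h1 : a' < m := lt_of_lt_of_le haq (hqu.trans hum.le)
    have h2 : (z ^ N).1 a' < (z ^ N).1 m := (z ^ N).2.1 h1
    rwa [PLSG.map_left _ rfl] at h2
  have hψmv : ((z ^ N).1 m : ℝ) < (z ^ N).1 v := (z ^ N).2.1 hmv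
  have hψv : (a : ℝ) < (z ^ N).1 v := hψm.trans hψmv
  -- for `μ` beyond this ratio, `ψ m ≤ g (ψ v)`, that is, `g⁻¹ m ≤ v`
  refine ⟨(((z ^ N).1 m : ℝ) - a) / (((z ^ N).1 v : ℝ) - a), div_pos (by linarith) (by linarith),
    (div_lt_one (by linarith)).2 (by linarith), fun g hg μ hμ hδ => ?_⟩
  by_contra hμ1
  rw [not_le] at hμ1
  obtain ⟨hμ0, w, haw, hgw⟩ := hμ
  have hge : ∀ t ≤ e, (g.1 t : ℝ) = a + μ * ((t : ℝ) - a) := by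
    intro t ht
    have hta := t.2.1
    have htb := t.2.2
    have h1 : μ * ((t : ℝ) - a) ≤ t - a := mul_le_of_le_one_left (by linarith) hμ1.le
    have h2 : 0 ≤ μ * ((t : ℝ) - a) := mul_nonneg hμ0.le (by linarith)
    have := linear_of_commute_contraction (d := fun t : Set.Icc (a : ℝ) b => (t : ℝ) - a)
      (fun x y h => Subtype.ext (sub_left_injective h)) (f := z.1) (g := g.1) z.2.1.injective
      (PLSG.commute_apply hg.symm) hc0 hc1 (ε := (e : ℝ) - a) (δ := (w : ℝ) - a) (sub_pos.2 haw)
      hμ0 hμ1.le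
      (fun t _ ht => by
        have h : t ≤ e := by change (t : ℝ) ≤ e; linarith
        change (z.1 t : ℝ) - a = _
        rw [hze t h]; ring)
      (fun t _ ht => by
        have h : t ≤ w := by change (t : ℝ) ≤ w; linarith
        change (g.1 t : ℝ) - a = _
        rw [hgw t h]; ring) (t := t) (by linarith)
      (sub_le_sub_right (show (t : ℝ) ≤ e from ht) _)
      ⟨⟨a + μ * ((t : ℝ) - a), by linarith, by linarith⟩, by simp⟩
    linarith
  -- elements commuting with `z` permute its fixed points, hence fix the first one
  have hple : ∀ k : PLSG S G a b, Commute k z → p ≤ k.1 p := by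
    intro k hk
    by_contra hlt
    rw [not_le] at hlt
    have h1 : (a : ℝ) < k.1 p := by
      have h2 : k.1 a' < k.1 p := k.2.1 (show a' < p from hap)
      rwa [PLSG.map_left _ rfl] at h2
    have h3 := hzlt _ h1 hlt
    rw [PLSG.commute_apply hk.symm, hzp] at h3
    exact lt_irrefl _ h3
  have hginv : Commute g⁻¹ z := hg.inv_left
  have hgp : (g⁻¹).1 p = p := by
    refine le_antisymm ?_ (hple _ hginv)
    have := (g⁻¹).2.1.monotone (hple g hg)
    rwa [PLSG.inv_apply_self] at this
  -- `g` moves points to the left near `a`; conjugation by powers of `z` spreads this to `[a, p)`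
  have hgle : ∀ t, t < p → t ≤ (g⁻¹).1 t := by
    intro t ht
    obtain ⟨n, hn⟩ := PLSG.exists_pow_apply_le z hzlt ht hae
    have h1 : g.1 ((z ^ n).1 t) ≤ (z ^ n).1 t := by
      change (g.1 ((z ^ n).1 t) : ℝ) ≤ (z ^ n).1 t
      have := ((z ^ n).1 t).2.1
      rw [hge _ hn]
      nlinarith
    rw [PLSG.commute_apply (hg.pow_right n)] at h1
    have h2 := (g⁻¹).2.1.monotone ((z ^ n).2.1.le_iff_le.1 h1)
    rwa [PLSG.inv_apply_self] at h2
  obtain ⟨r, hrp, κ, hκ0, hκ⟩ := PLSG.exists_affine_left g⁻¹ p hap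
  rw [hgp] at hκ
  have hκ1 : κ ≤ 1 := by
    have h1 : (r : ℝ) ≤ (g⁻¹).1 r := hgle r hrp
    have h2 : (r : ℝ) < p := hrp
    rw [hκ r le_rfl hrp.le] at h1
    by_contra hlt
    nlinarith
  have hgq : ∀ t, q ≤ t → t ≤ p → ((g⁻¹).1 t : ℝ) = p + κ * ((t : ℝ) - p) := by
    intro t hqt htp
    have htp' : (t : ℝ) ≤ p := htp
    have hta := t.2.1
    have hpb := p.2.2
    have h1 : κ * ((p : ℝ) - t) ≤ p - t := mul_le_of_le_one_left (by linarith) hκ1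
    have h2 : 0 ≤ κ * ((p : ℝ) - t) := mul_nonneg hκ0.le (by linarith)
    have := linear_of_commute_contraction (d := fun t : Set.Icc (a : ℝ) b => (p : ℝ) - t)
      (fun x y h => Subtype.ext (sub_right_injective h)) (f := (z⁻¹).1) (g := (g⁻¹).1)
      (z⁻¹).2.1.injective
      (PLSG.commute_apply hginv.symm.inv_left) hc'0 hc'1 (ε := (p : ℝ) - q) (δ := (p : ℝ) - r)
      (sub_pos.2 hrp) hκ0 hκ1
      (fun t h0 ht => by
        have h : q ≤ t := by change (q : ℝ) ≤ t; linarith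
        have h' : t ≤ p := by change (t : ℝ) ≤ p; linarith
        change (p : ℝ) - (z⁻¹).1 t = _
        rw [hzq t h h']; ring)
      (fun t h0 ht => by
        have h : r ≤ t := by change (r : ℝ) ≤ t; linarith
        have h' : t ≤ p := by change (t : ℝ) ≤ p; linarith
        change (p : ℝ) - (g⁻¹).1 t = _
        rw [hκ t h h']; ring) (t := t) (by linarith)
      (sub_le_sub_left (show (q : ℝ) ≤ t from hqt) _)
      ⟨⟨p - κ * ((p : ℝ) - t), by linarith, by linarith⟩, by simp⟩
    linarith
  have hgmv : (g⁻¹).1 m ≤ v := by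
    have h1 : (z ^ N).1 m ≤ g.1 ((z ^ N).1 v) := by
      change ((z ^ N).1 m : ℝ) ≤ g.1 ((z ^ N).1 v)
      rw [hge _ hN]
      rw [div_lt_iff₀ (by linarith)] at hδ
      linarith
    have h2 := (g⁻¹).2.1.monotone h1
    rw [PLSG.inv_apply_self, PLSG.commute_apply (hginv.pow_right N)] at h2
    exact (z ^ N).2.1.le_iff_le.1 h2
  -- the identity `ψ = g ψ g⁻¹` on `[u, m]`, where all maps involved are affine
  have key : ∀ t, u ≤ t → t ≤ m → ((z ^ N).1 v : ℝ) + d * ((t : ℝ) - v) =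
      a + μ * ((z ^ N).1 v + d * ((p : ℝ) + κ * ((t : ℝ) - p) - v) - a) := by
    intro t hut htm
    have htv : t ≤ v := htm.trans hmv.le
    have h1 : u ≤ (g⁻¹).1 t := hut.trans (hgle t (htv.trans_lt hvp))
    have h2 : (g⁻¹).1 t ≤ v := ((g⁻¹).2.1.monotone htm).trans hgmv
    have h3 : g.1 ((z ^ N).1 ((g⁻¹).1 t)) = (z ^ N).1 t := by
      rw [PLSG.commute_apply (hg.pow_right N), PLSG.apply_inv_self]
    have h4 := hge ((z ^ N).1 ((g⁻¹).1 t)) (((z ^ N).2.1.monotone h2).trans hN)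
    rw [h3, hd _ h1 h2, hgq t (hqu.trans hut) (htv.trans hvp.le), hd t hut htv] at h4
    exact h4
  have k1 := key u le_rfl hum.le
  have k2 := key m hum.le le_rfl
  have k3 : (1 - μ * κ) * (d * ((m : ℝ) - u)) = 0 := by linear_combination k2 - k1
  have k4 : (0 : ℝ) < m - u := sub_pos.2 hum
  have k5 : 0 < 1 - μ * κ := by nlinarith
  exact (mul_pos k5 (mul_pos hd0 k4)).ne' k3

theorem PLSG.centralizer_slopes_discrete (hab : a < b) (z : PLSG S G a b)
    (hz : logSlope hab z < 0) :
    ∃ r : ℝ, 0 < r ∧ ∀ g, Commute g z → 0 < logSlope hab g → r ≤ logSlope hab g := by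
  obtain ⟨δ, hδ0, hδ1, hδ⟩ := PLSG.exists_slope_gap z (hasLeftEndSlope_exp_logSlope hab z)
    (Real.exp_lt_one_iff.2 hz)
  refine ⟨-Real.log δ, neg_pos.2 (Real.log_neg hδ0 hδ1), fun g hg hpos => ?_⟩
  by_contra hlt
  rw [not_le] at hlt
  have h1 := logSlope_inv hab g
  have h4 := hδ g⁻¹ hg.inv_left _ (hasLeftEndSlope_exp_logSlope hab g⁻¹) (by
    rw [← Real.log_lt_iff_lt_exp hδ0]
    linarith)
  rw [Real.one_le_exp_iff] at h4
  linarith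

/-- An element that is not the identity and fixes no point of `S` inside `(a, b)` has infinite
cyclic centralizer. The homomorphism to `ℝ` used for this is `logSlope`; its values are discrete by
the slope gap, applied to `z` or `z⁻¹`, whichever has slope `< 1` at `a`. -/
theorem PLSG.isInfiniteCyclicOnRoot_centralizer (hab : a < b) {z : PLSG S G a b}
    (hz : z ∈ PLSG0 S G a b) (hz1 : z ≠ 1) :
    IsInfiniteCyclicOnRoot (Subgroup.centralizer {z}) z := by
  have hmem : ∀ g, g ∈ Subgroup.centralizer {z} ↔ Commute g z := fun g =>
    Subgroup.mem_centralizer_singleton_iff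
  have hinj : ∀ g, Commute g z → logSlope hab g = 0 → g = 1 := by
    intro g hg h0
    obtain ⟨-, v, hv, h⟩ := hasLeftEndSlope_exp_logSlope hab g
    refine PLSG.eq_one_of_commute hz hg hv fun t ht => Subtype.ext ?_
    rw [h t ht, h0, Real.exp_zero]
    ring
  have hz0 : logSlope hab z ≠ 0 := fun h => hz1 (hinj z (Commute.refl z) h)
  obtain ⟨r, hr, hiso⟩ : ∃ r : ℝ, 0 < r ∧
      ∀ g, Commute g z → 0 < logSlope hab g → r ≤ logSlope hab g := by
    rcases lt_or_gt_of_ne hz0 with h | h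
    · exact PLSG.centralizer_slopes_discrete hab z h
    · obtain ⟨r, hr, hiso⟩ := PLSG.centralizer_slopes_discrete hab z⁻¹ (by
        rw [logSlope_inv]
        linarith)
      exact ⟨r, hr, fun g hg => hiso g hg.inv_right⟩
  exact isInfiniteCyclicOnRoot_of_hom _ (logSlope hab) (logSlope_mul hab)
    (fun g hg => hinj g ((hmem g).1 hg)) hr (fun g hg => hiso g ((hmem g).1 hg))
    ((hmem z).2 (Commute.refl z)) hz1

end Isolation

/-! ### Restriction and gluing along a partition -/

section Restriction

variable {S : Subring ℝ} {G : Subgroup Sˣ} {a b : S}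

/-- An element of `PLSG` from its underlying function: continuity is automatic for a strictly
monotone surjection. -/
noncomputable def PLSG.ofStrictMono (f : Set.Icc (a : ℝ) b → Set.Icc (a : ℝ) b)
    (hf : StrictMono f) (hsurj : Function.Surjective f) (hPL : IsPL S G f) : PLSG S G a b :=
  ⟨(hf.orderIsoOfSurjective f hsurj).toHomeomorph, hf, hPL⟩

variable {a' b' : S}

theorem IsRestriction.mul {f g : PLSG S G a b} {h k : PLSG S G a' b'} (h1 : IsRestriction f h)
    (h2 : IsRestriction g k) : IsRestriction (f * g) (h * k) :=
  fun _ _ htt => h1 _ _ (h2 _ _ htt)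

theorem IsRestriction.unique (ha : (a : ℝ) ≤ a') (hb : (b' : ℝ) ≤ b) {f : PLSG S G a b}
    {h k : PLSG S G a' b'} (h1 : IsRestriction f h) (h2 : IsRestriction f k) : h = k :=
  PLSG.ext fun t => Subtype.ext <| by
    rw [← h1 ⟨t, ha.trans t.2.1, t.2.2.trans hb⟩ t rfl, h2 _ t rfl]

/-- A map fixing `a'` and `b'` restricts to `[a', b']`. -/
theorem PLSG.exists_isRestriction (ha : (a : ℝ) ≤ a') (hb : (b' : ℝ) ≤ b) (g : PLSG S G a b)
    (hga : ∀ t : Set.Icc (a : ℝ) b, (t : ℝ) = a' → g.1 t = t)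
    (hgb : ∀ t : Set.Icc (a : ℝ) b, (t : ℝ) = b' → g.1 t = t) :
    ∃ h : PLSG S G a' b', IsRestriction g h := by
  let ι : Set.Icc (a' : ℝ) b' → Set.Icc (a : ℝ) b :=
    fun t => ⟨t, ha.trans t.2.1, t.2.2.trans hb⟩
  have key : ∀ k : PLSG S G a b, (∀ t : Set.Icc (a : ℝ) b, (t : ℝ) = a' → k.1 t = t) →
      (∀ t : Set.Icc (a : ℝ) b, (t : ℝ) = b' → k.1 t = t) →
      ∀ t, (k.1 (ι t) : ℝ) ∈ Set.Icc (a' : ℝ) b' := by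
    intro k hka hkb t
    have hab : (a' : ℝ) ≤ b' := t.2.1.trans t.2.2
    have h1 := k.2.1.monotone (show ι ⟨a', le_rfl, hab⟩ ≤ ι t from t.2.1)
    have h2 := k.2.1.monotone (show ι t ≤ ι ⟨b', hab, le_rfl⟩ from t.2.2)
    rw [hka _ rfl] at h1
    rw [hkb (ι ⟨b', hab, le_rfl⟩) rfl] at h2
    exact ⟨h1, h2⟩
  have inv : ∀ t, g.1 t = t → (g⁻¹).1 t = t := fun t ht => by
    conv_lhs => rw [← ht]
    exact PLSG.inv_apply_self g t
  refine ⟨PLSG.ofStrictMono (fun t => ⟨g.1 (ι t), key g hga hgb t⟩) (fun s t hst => ?_)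
    (fun t => ?_) ?_, ?_⟩
  · exact g.2.1 (show ι s < ι t from hst)
  · refine ⟨⟨(g⁻¹).1 (ι t), key g⁻¹ (fun t ht => inv t (hga t ht))
      (fun t ht => inv t (hgb t ht)) t⟩, Subtype.ext ?_⟩
    change (g.1 ((g⁻¹).1 (ι t)) : ℝ) = t
    rw [PLSG.apply_inv_self]
  · obtain ⟨B, hBS, hB⟩ := g.2.2
    refine ⟨B, hBS, fun u v huv hfree => ?_⟩
    obtain ⟨c, hcG, hc⟩ := hB (ι u) (ι v) huv hfree
    exact ⟨c, hcG, fun t h1 h2 => hc (ι t) h1 h2⟩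
  · intro t t' htt
    have : t = ι t' := Subtype.ext htt
    rw [this]
    rfl

/-- The increasing sequence `α` cuts `[a, b]` into the intervals `[α i, α (i + 1)]`. -/
structure IsPartition (a b : S) {N : ℕ} (α : Fin (N + 1) → S) : Prop where
  strictMono : StrictMono α
  left : α 0 = a
  right : α (Fin.last N) = b

variable {N : ℕ} {α : Fin (N + 1) → S}

theorem IsPartition.left_le (h : IsPartition a b α) (j : Fin (N + 1)) : (a : ℝ) ≤ α j := by
  have := h.strictMono.monotone (Fin.zero_le j)
  rw [h.left] at this
  exact this

theorem IsPartition.le_right (h : IsPartition a b α) (j : Fin (N + 1)) : (α j : ℝ) ≤ b := by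
  have := h.strictMono.monotone (Fin.le_last j)
  rw [h.right] at this
  exact this

theorem IsPartition.exists_mem (h : IsPartition a b α) (hab : a < b) {t : ℝ} (hat : a ≤ t)
    (htb : t ≤ b) : ∃ i : Fin N, t ∈ Set.Icc (α i.castSucc : ℝ) (α i.succ) := by
  by_contra! hcon
  have hle : ∀ j : Fin (N + 1), (α j : ℝ) ≤ t := by
    intro j
    induction j using Fin.induction with
    | zero => rw [h.left]; exact hat
    | succ i ih => exact le_of_not_ge fun h1 => hcon i ⟨ih, h1⟩
  cases N with
  | zero =>
    have h1 := h.left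
    rw [← h.right] at hab
    exact absurd hab (by rw [← h1]; exact lt_irrefl _)
  | succ M =>
    refine hcon (Fin.last M) ⟨hle _, ?_⟩
    rw [Fin.succ_last, h.right]
    exact htb

theorem IsPartition.succ_le (h : IsPartition a b α) {i j : Fin N} (hij : i < j) :
    (α i.succ : ℝ) ≤ α j.castSucc :=
  h.strictMono.monotone (Fin.succ_le_castSucc_iff.2 hij)

theorem IsPartition.eq_of_isRestriction (h : IsPartition a b α) (hab : a < b)
    {f g : PLSG S G a b} {y : ∀ i : Fin N, PLSG S G (α i.castSucc) (α i.succ)}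
    (hf : ∀ i, IsRestriction f (y i)) (hg : ∀ i, IsRestriction g (y i)) : f = g :=
  PLSG.ext fun t => Subtype.ext <| by
    obtain ⟨i, hi⟩ := h.exists_mem hab t.2.1 t.2.2
    rw [hf i t ⟨t, hi⟩ rfl, hg i t ⟨t, hi⟩ rfl]

/-- Elements of the groups of the pieces of a partition glue. -/
theorem IsPartition.exists_glue (h : IsPartition a b α) (hab : a < b)
    (y : ∀ i : Fin N, PLSG S G (α i.castSucc) (α i.succ)) :
    ∃ g : PLSG S G a b, ∀ i, IsRestriction g (y i) := by
  classical
  -- strict monotonicity and well-definedness of the glued map, across pieces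
  have hlt : ∀ (i j : Fin N) (s : Set.Icc (α i.castSucc : ℝ) (α i.succ))
      (t : Set.Icc (α j.castSucc : ℝ) (α j.succ)), (s : ℝ) < t →
      ((y i).1 s : ℝ) < (y j).1 t := by
    intro i j s t hst
    rcases lt_trichotomy i j with hij | rfl | hij
    · by_contra hge
      rw [not_lt] at hge
      have h1 := h.succ_le hij
      have h2 := ((y i).1 s).2.2
      have h3 := ((y j).1 t).2.1
      have h4 : (y i).1 s = s := by
        refine (y i).2.1.injective ?_
        rw [PLSG.map_right (y i) (le_antisymm h2 (by linarith))]
      have h5 : (y j).1 t = t := by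
        refine (y j).2.1.injective ?_
        rw [PLSG.map_left (y j) (le_antisymm (by linarith) h3)]
      rw [h4, h5] at hge
      exact absurd hst (not_lt.2 hge)
    · exact (y i).2.1 hst
    · have h1 := h.succ_le hij
      have h2 := s.2.1
      have h3 := t.2.2
      linarith
  have heq : ∀ (i j : Fin N) (s : Set.Icc (α i.castSucc : ℝ) (α i.succ))
      (t : Set.Icc (α j.castSucc : ℝ) (α j.succ)), (s : ℝ) = t →
      ((y i).1 s : ℝ) = (y j).1 t := by
    have aux : ∀ (i j : Fin N) (s : Set.Icc (α i.castSucc : ℝ) (α i.succ))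
        (t : Set.Icc (α j.castSucc : ℝ) (α j.succ)), i < j → (s : ℝ) = t →
        ((y i).1 s : ℝ) = (y j).1 t := by
      intro i j s t hij hst
      have h1 := h.succ_le hij
      have h2 := s.2.2
      have h3 := t.2.1
      rw [PLSG.map_right (y i) (t := s) (by linarith), PLSG.map_left (y j) (t := t) (by linarith),
        hst]
    intro i j s t hst
    rcases lt_trichotomy i j with hij | rfl | hij
    · exact aux i j s t hij hst
    · rw [Subtype.ext hst]
    · exact (aux j i t s hij hst.symm).symm
  choose idx hidx using fun t : Set.Icc (a : ℝ) b => h.exists_mem hab t.2.1 t.2.2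
  let ι : ∀ i : Fin N, Set.Icc (α i.castSucc : ℝ) (α i.succ) → Set.Icc (a : ℝ) b :=
    fun i t => ⟨t, (h.left_le _).trans t.2.1, t.2.2.trans (h.le_right _)⟩
  let F : Set.Icc (a : ℝ) b → Set.Icc (a : ℝ) b :=
    fun t => ι (idx t) ((y (idx t)).1 ⟨t, hidx t⟩)
  have hF : ∀ (i : Fin N) (t : Set.Icc (α i.castSucc : ℝ) (α i.succ)) (s : Set.Icc (a : ℝ) b),
      (s : ℝ) = t → (F s : ℝ) = (y i).1 t := fun i t s hst => heq _ i ⟨s, hidx s⟩ t hst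
  have hPL : IsPL S G F := by
    choose B hBS hB using fun i => (y i).2.2
    refine ⟨(Finset.univ.biUnion B) ∪ Finset.univ.image (fun j => (α j : ℝ)), ?_, ?_⟩
    · intro p hp
      rcases Finset.mem_union.1 hp with hp | hp
      · obtain ⟨i, -, hi⟩ := Finset.mem_biUnion.1 hp
        exact hBS i p hi
      · obtain ⟨j, -, rfl⟩ := Finset.mem_image.1 hp
        exact (α j).2
    · intro u v huv hfree
      have huv' : (u : ℝ) < v := huv
      obtain ⟨i, hi⟩ := h.exists_mem hab (t := ((u : ℝ) + v) / 2)
        (by have := u.2.1; have := v.2.1; linarith) (by have := u.2.2; have := v.2.2; linarith)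
      have hα : ∀ j, ¬((u : ℝ) < α j ∧ (α j : ℝ) < v) := fun j => hfree _
        (Finset.mem_union_right _ (Finset.mem_image.2 ⟨j, Finset.mem_univ j, rfl⟩))
      have hi1 := hi.1
      have hi2 := hi.2
      have hu : (α i.castSucc : ℝ) ≤ u := by
        by_contra hlt
        exact hα i.castSucc ⟨not_le.1 hlt, by linarith⟩
      have hv : (v : ℝ) ≤ α i.succ := by
        by_contra hlt
        exact hα i.succ ⟨by linarith, not_le.1 hlt⟩
      obtain ⟨c, hcG, hc⟩ := hB i ⟨u, hu, huv'.le.trans hv⟩ ⟨v, hu.trans huv'.le, hv⟩ huv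
        (fun p hp => hfree p (Finset.mem_union_left _
          (Finset.mem_biUnion.2 ⟨i, Finset.mem_univ i, hp⟩)))
      refine ⟨c, hcG, fun t h1 h2 => ?_⟩
      have hut : (u : ℝ) ≤ t := h1
      have htv : (t : ℝ) ≤ v := h2
      rw [hF i ⟨t, hu.trans hut, htv.trans hv⟩ t rfl, hF i ⟨u, hu, huv'.le.trans hv⟩ u rfl]
      exact hc _ h1 h2
  have hmono : StrictMono F := fun s t hst => hlt _ _ ⟨s, hidx s⟩ ⟨t, hidx t⟩ hst
  have hsurj : Function.Surjective F := by
    intro t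
    obtain ⟨i, hi⟩ := h.exists_mem hab t.2.1 t.2.2
    refine ⟨ι i (((y i)⁻¹).1 ⟨t, hi⟩), Subtype.ext ?_⟩
    rw [hF i (((y i)⁻¹).1 ⟨t, hi⟩) _ rfl, PLSG.apply_inv_self]
  exact ⟨PLSG.ofStrictMono F hmono hsurj hPL, fun i s t hst => hF i t s hst⟩

/-- If every element commuting with `z` fixes the points of a partition, then the centralizer of
`z` is the product of the centralizers of the restrictions of `z` to the pieces. -/
theorem IsPartition.exists_centralizer_mulEquiv (h : IsPartition a b α) (hab : a < b)
    {z : PLSG S G a b} {y : ∀ i : Fin N, PLSG S G (α i.castSucc) (α i.succ)}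
    (hy : ∀ i, IsRestriction z (y i))
    (hfix : ∀ g, Commute g z → ∀ (j : Fin (N + 1)) (t : Set.Icc (a : ℝ) b), (t : ℝ) = α j →
      g.1 t = t) :
    ∃ φ : Subgroup.centralizer {z} ≃* (∀ i : Fin N, Subgroup.centralizer {y i}),
      ∀ g i, IsRestriction g.1 (φ g i).1 := by
  have hcomm : ∀ g : Subgroup.centralizer {z}, Commute g.1 z := fun g =>
    Subgroup.mem_centralizer_singleton_iff.1 g.2
  have uniq : ∀ (i : Fin N) {f : PLSG S G a b} {k l : PLSG S G (α i.castSucc) (α i.succ)},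
      IsRestriction f k → IsRestriction f l → k = l := fun i _ _ _ h1 h2 =>
    h1.unique (h.left_le _) (h.le_right _) h2
  have hex : ∀ (g : Subgroup.centralizer {z}) (i : Fin N),
      ∃ k : Subgroup.centralizer {y i}, IsRestriction g.1 k.1 := by
    intro g i
    obtain ⟨k, hk⟩ := PLSG.exists_isRestriction (h.left_le i.castSucc) (h.le_right i.succ) g.1
      (hfix _ (hcomm g) _) (hfix _ (hcomm g) _)
    refine ⟨⟨k, Subgroup.mem_centralizer_singleton_iff.2 ?_⟩, hk⟩
    refine uniq i (hk.mul (hy i)) ?_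
    rw [(hcomm g).eq]
    exact (hy i).mul hk
  choose φ hφ using hex
  have hmul : ∀ f g, φ (f * g) = φ f * φ g := fun f g => funext fun i =>
    Subtype.ext (uniq i (hφ (f * g) i) ((hφ f i).mul (hφ g i)))
  refine ⟨MulEquiv.ofBijective (MonoidHom.mk' φ hmul) ⟨fun f g hfg => ?_, fun k => ?_⟩, hφ⟩
  · refine Subtype.ext (h.eq_of_isRestriction hab (hφ f) fun i => ?_)
    have : φ f = φ g := hfg
    rw [this]
    exact hφ g i
  · obtain ⟨g, hg⟩ := h.exists_glue hab (fun i => (k i).1)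
    have hgz : g ∈ Subgroup.centralizer {z} := by
      refine Subgroup.mem_centralizer_singleton_iff.2
        (h.eq_of_isRestriction hab (fun i => (hg i).mul (hy i)) fun i => ?_)
      have h1 : (k i).1 * y i = y i * (k i).1 := Subgroup.mem_centralizer_singleton_iff.1 (k i).2
      rw [h1]
      exact (hy i).mul (hg i)
    exact ⟨⟨g, hgz⟩, funext fun i => Subtype.ext (uniq i (hφ ⟨g, hgz⟩ i) (hg i))⟩

end Restriction

/-! ### Cut points -/

section CutPoints

variable {S : Subring ℝ} {G : Subgroup Sˣ} {a b : S}

/-- On an open set where `f` is affine about a fixed point `x` outside the set, either every point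
is fixed or none is. -/
theorem PLSG.notMem_frontier_of_affine (f : PLSG S G a b) {x : Set.Icc (a : ℝ) b}
    {U : Set (Set.Icc (a : ℝ) b)} (hU : IsOpen U) (hxU : x ∉ U) {c : ℝ}
    (hc : ∀ t ∈ U, (f.1 t : ℝ) = x + c * ((t : ℝ) - x)) {t : Set.Icc (a : ℝ) b} (ht : t ∈ U) :
    t ∉ frontier (fixedSet f) := by
  rw [(PLSG.isClosed_fixedSet f).frontier_eq]
  rintro ⟨h1, h2⟩
  have h1' : f.1 t = t := h1
  have h3 := hc t ht
  rw [h1'] at h3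
  have h4 : (t : ℝ) - x ≠ 0 := sub_ne_zero.2 fun h => hxU (Subtype.ext h ▸ ht)
  have h5 : c = 1 := by
    apply mul_right_cancel₀ h4
    linarith
  refine h2 (mem_interior.2 ⟨U, fun s hs => Subtype.ext ?_, hU, ht⟩)
  rw [hc s hs, h5]
  ring

theorem PLSG.finite_frontier_fixedSet (f : PLSG S G a b) : (frontier (fixedSet f)).Finite := by
  by_contra hinf
  obtain ⟨x, hx, hacc⟩ := Set.Infinite.exists_accPt_of_subset_isCompact hinf
    isClosed_frontier.isCompact subset_rfl
  have hfx : f.1 x = x := (PLSG.isClosed_fixedSet f).frontier_subset hx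
  rw [accPt_iff_frequently_nhdsNE] at hacc
  refine hacc ?_
  rw [← nhdsLT_sup_nhdsGT, Filter.eventually_sup]
  constructor
  · rcases eq_or_lt_of_le x.2.1 with h | h
    · have : Set.Iio x = ∅ := Set.eq_empty_of_forall_notMem fun t ht =>
        absurd t.2.1 (not_le.2 (lt_of_lt_of_eq (show (t : ℝ) < x from ht) h.symm))
      rw [this, nhdsWithin_empty]
      exact Filter.eventually_bot
    · obtain ⟨u, hux, c, -, hc⟩ := PLSG.exists_affine_left f x h
      rw [hfx] at hc
      filter_upwards [Ioo_mem_nhdsLT hux] with t ht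
      exact PLSG.notMem_frontier_of_affine f isOpen_Ioo (fun h => lt_irrefl _ h.2)
        (fun s hs => hc s hs.1.le hs.2.le) ht
  · rcases eq_or_lt_of_le x.2.2 with h | h
    · have : Set.Ioi x = ∅ := Set.eq_empty_of_forall_notMem fun t ht =>
        absurd t.2.2 (not_le.2 (lt_of_eq_of_lt h.symm (show (x : ℝ) < t from ht)))
      rw [this, nhdsWithin_empty]
      exact Filter.eventually_bot
    · obtain ⟨v, hxv, c, -, hc⟩ := PLSG.exists_affine_right f x h
      rw [hfx] at hc
      filter_upwards [Ioo_mem_nhdsGT hxv] with t ht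
      exact PLSG.notMem_frontier_of_affine f isOpen_Ioo (fun h => lt_irrefl _ h.1)
        (fun s hs => hc s hs.1.le hs.2.le) ht

theorem finite_cutPoints (f : PLSG S G a b) : (cutPoints f).Finite := by
  have h : cutPoints f ⊆ {a} ∪ ({b} ∪ Subtype.val ⁻¹'
      ((fun t : Set.Icc (a : ℝ) b => (t : ℝ)) '' frontier (fixedSet f))) := by
    rintro s (h | h | ⟨t, ht, hts⟩)
    · exact Or.inl h
    · exact Or.inr (Or.inl h)
    · exact Or.inr (Or.inr ⟨t, ht, hts⟩)
  exact ((Set.finite_singleton _).union ((Set.finite_singleton _).union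
    (((PLSG.finite_frontier_fixedSet f).image _).preimage Subtype.val_injective.injOn))).subset h

theorem mem_Icc_of_mem_cutPoints (hab : a < b) {f : PLSG S G a b} {s : S} (hs : s ∈ cutPoints f) :
    a ≤ s ∧ s ≤ b := by
  rcases hs with rfl | rfl | ⟨t, -, ht⟩
  · exact ⟨le_rfl, hab.le⟩
  · exact ⟨hab.le, le_rfl⟩
  · exact ⟨show (a : ℝ) ≤ s from ht ▸ t.2.1, show (s : ℝ) ≤ b from ht ▸ t.2.2⟩

theorem exists_enum_cutPoints (f : PLSG S G a b) :
    ∃ (N : ℕ) (α : Fin (N + 1) → S), StrictMono α ∧ Set.range α = cutPoints f := by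
  classical
  let C := (finite_cutPoints f).toFinset
  have hC : C.card ≠ 0 := Finset.card_ne_zero.2
    ⟨a, (finite_cutPoints f).mem_toFinset.2 (Or.inl rfl)⟩
  obtain ⟨N, hN⟩ := Nat.exists_eq_succ_of_ne_zero hC
  exact ⟨N, C.orderEmbOfFin hN, (C.orderEmbOfFin hN).strictMono, by
    rw [Finset.range_orderEmbOfFin, Set.Finite.coe_toFinset]⟩

variable {N : ℕ} {α : Fin (N + 1) → S}

theorem isPartition_of_range_eq_cutPoints (hab : a < b) {f : PLSG S G a b} (hα : StrictMono α)
    (hr : Set.range α = cutPoints f) : IsPartition a b α := by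
  have hmem : ∀ j, a ≤ α j ∧ α j ≤ b := fun j =>
    mem_Icc_of_mem_cutPoints hab (hr ▸ Set.mem_range_self j)
  obtain ⟨i, hi⟩ : a ∈ Set.range α := hr ▸ Or.inl rfl
  obtain ⟨j, hj⟩ : b ∈ Set.range α := hr ▸ Or.inr (Or.inl rfl)
  refine ⟨hα, le_antisymm ?_ (hmem 0).1, le_antisymm (hmem _).2 ?_⟩
  · rw [← hi]
    exact hα.monotone (Fin.zero_le i)
  · rw [← hj]
    exact hα.monotone (Fin.le_last j)

theorem PLSG.mem_frontier_of_commute {f g : PLSG S G a b} (h : Commute g f)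
    {t : Set.Icc (a : ℝ) b} (ht : t ∈ frontier (fixedSet f)) :
    g.1 t ∈ frontier (fixedSet f) := by
  have key : ∀ k : PLSG S G a b, Commute k f → ∀ s ∈ fixedSet f, k.1 s ∈ fixedSet f := by
    intro k hk s hs
    change f.1 (k.1 s) = k.1 s
    rw [PLSG.commute_apply hk.symm, show f.1 s = s from hs]
  have himg : g.1 '' fixedSet f = fixedSet f := by
    ext s
    constructor
    · rintro ⟨r, hr, rfl⟩
      exact key g h r hr
    · intro hs
      exact ⟨(g⁻¹).1 s, key g⁻¹ h.inv_left s hs, PLSG.apply_inv_self g s⟩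
  rw [← himg, ← g.1.image_frontier]
  exact ⟨t, ht, rfl⟩

/-- The centralizer of `f` fixes the cut points: it permutes this finite set preserving the
order. -/
theorem PLSG.apply_eq_of_commute (hab : a < b) {f g : PLSG S G a b} (hα : StrictMono α)
    (hr : Set.range α = cutPoints f) (h : Commute g f) (j : Fin (N + 1)) (t : Set.Icc (a : ℝ) b)
    (ht : (t : ℝ) = α j) : g.1 t = t := by
  have hp := isPartition_of_range_eq_cutPoints hab hα hr
  let P : Fin (N + 1) → Set.Icc (a : ℝ) b := fun j => ⟨α j, hp.left_le j, hp.le_right j⟩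
  have hP : StrictMono P := fun i j hij => hα hij
  have hle : ∀ k : PLSG S G a b, Commute k f → P j ≤ k.1 (P j) := by
    intro k hk
    have hex : ∀ i, ∃ l, k.1 (P i) = P l := by
      intro i
      have hcut : (⟨k.1 (P i), PLSG.map_mem k (P i) (α i).2⟩ : S) ∈ cutPoints f := by
        have hi : α i ∈ cutPoints f := hr ▸ Set.mem_range_self i
        rcases hi with hi | hi | ⟨s, hs, hsi⟩
        · refine Or.inl (Subtype.ext ?_)
          change (k.1 (P i) : ℝ) = a
          rw [PLSG.map_left k (t := P i) (congrArg Subtype.val hi)]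
          exact congrArg Subtype.val hi
        · refine Or.inr (Or.inl (Subtype.ext ?_))
          change (k.1 (P i) : ℝ) = b
          rw [PLSG.map_right k (t := P i) (congrArg Subtype.val hi)]
          exact congrArg Subtype.val hi
        · have : s = P i := Subtype.ext hsi
          exact Or.inr (Or.inr ⟨k.1 s, PLSG.mem_frontier_of_commute hk hs, by rw [this]⟩)
      rw [← hr] at hcut
      obtain ⟨l, hl⟩ := hcut
      exact ⟨l, Subtype.ext (congrArg Subtype.val hl).symm⟩
    choose σ hσ using hex
    have hσm : StrictMono σ := by
      intro i l hil
      have := k.2.1 (hP hil)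
      rw [hσ, hσ] at this
      exact hP.lt_iff_lt.1 this
    rw [hσ]
    exact hP.monotone hσm.le_apply
  have htP : t = P j := Subtype.ext ht
  rw [htP]
  refine le_antisymm ?_ (hle g h)
  have := g.2.1.monotone (hle g⁻¹ h.inv_left)
  rwa [PLSG.apply_inv_self] at this

theorem PLSG.exists_restrictions (hab : a < b) {f : PLSG S G a b} (hα : StrictMono α)
    (hr : Set.range α = cutPoints f) :
    ∃ y : ∀ i : Fin N, PLSG S G (α i.castSucc) (α i.succ), ∀ i, IsRestriction f (y i) := by
  have hp := isPartition_of_range_eq_cutPoints hab hα hr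
  have hfix := fun j => PLSG.apply_eq_of_commute hab hα hr (Commute.refl f) j
  choose y hy using fun i : Fin N => PLSG.exists_isRestriction (hp.left_le i.castSucc)
    (hp.le_right i.succ) f (hfix _) (hfix _)
  exact ⟨y, hy⟩

theorem notMem_frontier_of_between (hα : StrictMono α) {f : PLSG S G a b}
    (hr : Set.range α = cutPoints f) (i : Fin N) {t : Set.Icc (a : ℝ) b} (htS : (t : ℝ) ∈ S)
    (h1 : (α i.castSucc : ℝ) < t) (h2 : (t : ℝ) < α i.succ) : t ∉ frontier (fixedSet f) := by
  intro ht
  have hcut : (⟨t, htS⟩ : S) ∈ cutPoints f := Or.inr (Or.inr ⟨t, ht, rfl⟩)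
  rw [← hr] at hcut
  obtain ⟨j, hj⟩ := hcut
  have hj' : (α j : ℝ) = t := congrArg Subtype.val hj
  rw [← hj'] at h1 h2
  have h3 : i.castSucc < j := hα.lt_iff_lt.1 (show α i.castSucc < α j from h1)
  have h4 : j < i.succ := hα.lt_iff_lt.1 (show α j < α i.succ from h2)
  exact absurd (Fin.castSucc_lt_iff_succ_le.1 h3) (not_le.2 h4)

/-- Between consecutive cut points, `f` is the identity or fixes no point of `S`: the interior of
the fixed-point set is open and closed in the open interval. -/
theorem mem_PLSG0_of_ne_one (hab : a < b) {f : PLSG S G a b} (hα : StrictMono α)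
    (hr : Set.range α = cutPoints f) {y : ∀ i : Fin N, PLSG S G (α i.castSucc) (α i.succ)}
    (hy : ∀ i, IsRestriction f (y i)) {i : Fin N} (hi : y i ≠ 1) :
    y i ∈ PLSG0 S G (α i.castSucc) (α i.succ) := by
  intro t ht htS
  by_contra! hne
  have hp := isPartition_of_range_eq_cutPoints hab hα hr
  let ι : Set.Icc (α i.castSucc : ℝ) (α i.succ) → Set.Icc (a : ℝ) b :=
    fun t => ⟨t, (hp.left_le _).trans t.2.1, t.2.2.trans (hp.le_right _)⟩
  let l : Set.Icc (a : ℝ) b := ⟨α i.castSucc, hp.left_le _, hp.le_right _⟩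
  let r : Set.Icc (a : ℝ) b := ⟨α i.succ, hp.left_le _, hp.le_right _⟩
  have hint : ∀ x ∈ Set.Ioo l r, (x : ℝ) ∈ S → x ∈ fixedSet f →
      x ∈ interior (fixedSet f) := by
    intro x hx hxS hfx
    have h1 := notMem_frontier_of_between hα hr i hxS hx.1 hx.2
    rw [(PLSG.isClosed_fixedSet f).frontier_eq] at h1
    by_contra h2
    exact h1 ⟨hfx, h2⟩
  have htI : ι t ∈ Set.Ioo l r :=
    ⟨(lt_of_le_of_ne t.2.1 hne.1.symm : (α i.castSucc : ℝ) < t),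
      (lt_of_le_of_ne t.2.2 hne.2 : (t : ℝ) < α i.succ)⟩
  have hft : f.1 (ι t) = ι t := Subtype.ext (by rw [hy i (ι t) t rfl, ht])
  have hsub : Set.Ioo l r ⊆ interior (fixedSet f) := by
    refine (isPreconnected_of_ordConnected_Icc
      Set.ordConnected_Ioo).subset_of_closure_inter_subset isOpen_interior
      ⟨ι t, htI, hint _ htI htS hft⟩ ?_
    rintro x ⟨hx1, hx2⟩
    by_cases hxS : (x : ℝ) ∈ S
    · exact hint x hx2 hxS (closure_minimal interior_subset (PLSG.isClosed_fixedSet f) hx1)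
    · exact PLSG.mem_interior_fixedSet f hxS hx1
  refine hi (PLSG.ext fun s => ?_)
  rw [PLSG.one_apply]
  rcases eq_or_lt_of_le s.2.1 with h1 | h1
  · exact PLSG.map_left _ h1.symm
  · rcases eq_or_lt_of_le s.2.2 with h2 | h2
    · exact PLSG.map_right _ h2
    · have h3 : f.1 (ι s) = ι s := interior_subset (s := fixedSet f) (hsub ⟨h1, h2⟩)
      refine Subtype.ext ?_
      rw [← hy i (ι s) s rfl, h3]

/-- Two adjacent pieces are not both fixed pointwise, since otherwise their common endpoint would
not be in the boundary of the fixed-point set. -/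
theorem restriction_ne_one_of_succ_eq (hab : a < b) {f : PLSG S G a b} (hα : StrictMono α)
    (hr : Set.range α = cutPoints f) {y : ∀ i : Fin N, PLSG S G (α i.castSucc) (α i.succ)}
    (hy : ∀ i, IsRestriction f (y i)) {i j : Fin N} (hij : i.succ = j.castSucc) (hi : y i = 1) :
    y j ≠ 1 := by
  intro hj
  have hp := isPartition_of_range_eq_cutPoints hab hα hr
  let P : Fin (N + 1) → Set.Icc (a : ℝ) b := fun j => ⟨α j, hp.left_le j, hp.le_right j⟩
  have hP : StrictMono P := fun i j hij => hα hij
  have h1 : P i.castSucc < P j.castSucc := by rw [← hij]; exact hP (Fin.castSucc_lt_succ)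
  have h2 : P j.castSucc < P j.succ := hP (Fin.castSucc_lt_succ)
  have hsub : Set.Ioo (P i.castSucc) (P j.succ) ⊆ fixedSet f := by
    intro t ht
    refine Subtype.ext ?_
    rcases le_total t (P j.castSucc) with h | h
    · have h' : (t : ℝ) ≤ α i.succ := by rw [hij]; exact h
      rw [hy i t ⟨t, ht.1.le, h'⟩ rfl, hi, PLSG.one_apply]
    · rw [hy j t ⟨t, h, ht.2.le⟩ rfl, hj, PLSG.one_apply]
  have hcut : α j.castSucc ∈ cutPoints f := hr ▸ Set.mem_range_self _
  rcases hcut with h | h | ⟨t, ht, hts⟩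
  · have h3 : (a : ℝ) < α j.castSucc :=
      (hp.left_le i.castSucc).trans_lt (show (α i.castSucc : ℝ) < α j.castSucc from h1)
    rw [h] at h3
    exact lt_irrefl _ h3
  · have h3 : (α j.castSucc : ℝ) < b :=
      (show (α j.castSucc : ℝ) < α j.succ from h2).trans_le (hp.le_right j.succ)
    rw [h] at h3
    exact lt_irrefl _ h3
  · have htP : t = P j.castSucc := Subtype.ext hts
    rw [htP] at ht
    exact ht.2 (mem_interior.2 ⟨_, hsub, isOpen_Ioo, h1, h2⟩)

end CutPoints

/-! ### Products of centralizers, and isomorphisms between the groups of different intervals -/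

section Product

theorem Subgroup.centralizer_singleton_of_eq_one {Γ : Type*} [Group Γ] {y : Γ} (hy : y = 1) :
    Subgroup.centralizer {y} = ⊤ := by
  subst hy
  exact eq_top_iff.2 fun g _ => Subgroup.mem_centralizer_singleton_iff.2 (by simp)

theorem nonempty_pi_centralizer_mulEquiv {ι : Type*} {Γ : ι → Type*} [∀ i, Group (Γ i)]
    (y : ∀ i, Γ i)
    (h : ∀ i, y i ≠ 1 → IsInfiniteCyclicOnRoot (Subgroup.centralizer {y i}) (y i)) :
    Nonempty ((∀ i, Subgroup.centralizer {y i}) ≃*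
      (∀ i : {i // y i = 1}, Γ i.1) × ({i // y i ≠ 1} → Multiplicative ℤ)) := by
  classical
  let e : (∀ i, Subgroup.centralizer {y i}) ≃*
      (∀ i : {i // y i = 1}, Subgroup.centralizer {y i.1}) ×
        (∀ i : {i // y i ≠ 1}, Subgroup.centralizer {y i.1}) :=
    { Equiv.piEquivPiSubtypeProd (fun i => y i = 1) (fun i => Subgroup.centralizer {y i}) with
      map_mul' := fun _ _ => rfl }
  let e1 : ∀ i : {i // y i = 1}, Subgroup.centralizer {y i.1} ≃* Γ i.1 := fun i =>
    (MulEquiv.subgroupCongr (Subgroup.centralizer_singleton_of_eq_one i.2)).trans Subgroup.topEquiv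
  let e2 : ∀ i : {i // y i ≠ 1}, Subgroup.centralizer {y i.1} ≃* Multiplicative ℤ := fun i =>
    (h i.1 i.2).nonempty_mulEquiv.some
  exact ⟨e.trans (MulEquiv.prodCongr (MulEquiv.piCongrRight e1) (MulEquiv.piCongrRight e2))⟩

end Product

section Conjugation

variable {S : Subring ℝ} {G : Subgroup Sˣ}

/-- The analogue of `IsPL` for maps between two intervals. -/
def IsPLMap (S : Subring ℝ) (G : Subgroup Sˣ) {a b c d : ℝ} (f : Set.Icc a b → Set.Icc c d) :
    Prop :=
  ∃ B : Finset ℝ, (∀ p ∈ B, p ∈ S) ∧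
    ∀ u v : Set.Icc a b, u < v → (∀ p ∈ B, ¬ ((u : ℝ) < p ∧ p < (v : ℝ))) →
      ∃ k ∈ G, ∀ t : Set.Icc a b, u ≤ t → t ≤ v →
        (f t : ℝ) = (f u : ℝ) + ((k : S) : ℝ) * ((t : ℝ) - (u : ℝ))

theorem IsPLMap.symm {a b c d : ℝ} {f : Set.Icc a b ≃o Set.Icc c d} (h : IsPLMap S G f)
    (hmem : ∀ t : Set.Icc a b, (t : ℝ) ∈ S → (f t : ℝ) ∈ S) : IsPLMap S G f.symm := by
  classical
  obtain ⟨B, hB, hlin⟩ := h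
  refine ⟨(B.subtype (fun p => p ∈ Set.Icc a b)).image (fun p => (f p : ℝ)), ?_, ?_⟩
  · intro q hq
    obtain ⟨p, hp, rfl⟩ := Finset.mem_image.1 hq
    exact hmem p (hB p (Finset.mem_subtype.1 hp))
  · intro u v huv hfree
    obtain ⟨k, hkG, hk⟩ := hlin (f.symm u) (f.symm v) (f.symm.strictMono huv) (by
      rintro p hp ⟨h1, h2⟩
      let p' : Set.Icc a b := ⟨p, (f.symm u).2.1.trans h1.le, h2.le.trans (f.symm v).2.2⟩
      refine hfree (f p') (Finset.mem_image.2 ⟨p', Finset.mem_subtype.2 hp, rfl⟩)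
        ⟨f.symm_apply_lt.1 h1, f.lt_symm_apply.1 h2⟩)
    refine ⟨k⁻¹, G.inv_mem hkG, fun t h1 h2 => ?_⟩
    have h3 := hk (f.symm t) (f.symm.monotone h1) (f.symm.monotone h2)
    rw [f.apply_symm_apply, f.apply_symm_apply] at h3
    have h4 : (((k⁻¹ : Sˣ) : S) : ℝ) * ((k : S) : ℝ) = 1 :=
      congrArg (fun s : S => (s : ℝ)) (Units.inv_mul k)
    linear_combination (-(((k⁻¹ : Sˣ) : S) : ℝ)) * h3 - ((f.symm t : ℝ) - (f.symm u : ℝ)) * h4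

theorem IsPLMap.comp {a b c d a' b' : ℝ} {f : Set.Icc c d → Set.Icc a' b'}
    {g : Set.Icc a b ≃o Set.Icc c d} (hf : IsPLMap S G f) (hg : IsPLMap S G g)
    (hmem : ∀ t : Set.Icc c d, (t : ℝ) ∈ S → (g.symm t : ℝ) ∈ S) : IsPLMap S G (f ∘ g) := by
  classical
  obtain ⟨B, hB, hlin⟩ := hf
  obtain ⟨B', hB', hlin'⟩ := hg
  refine ⟨B' ∪ (B.subtype (fun p => p ∈ Set.Icc c d)).image (fun p => (g.symm p : ℝ)), ?_, ?_⟩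
  · intro q hq
    rcases Finset.mem_union.1 hq with hq | hq
    · exact hB' q hq
    · obtain ⟨p, hp, rfl⟩ := Finset.mem_image.1 hq
      exact hmem p (hB p (Finset.mem_subtype.1 hp))
  · intro u v huv hfree
    obtain ⟨k', hkG', hk'⟩ := hlin' u v huv (fun p hp => hfree p (Finset.mem_union_left _ hp))
    obtain ⟨k, hkG, hk⟩ := hlin (g u) (g v) (g.strictMono huv) (by
      rintro p hp ⟨h1, h2⟩
      let p' : Set.Icc c d := ⟨p, (g u).2.1.trans h1.le, h2.le.trans (g v).2.2⟩
      exact hfree (g.symm p') (Finset.mem_union_right _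
        (Finset.mem_image.2 ⟨p', Finset.mem_subtype.2 hp, rfl⟩))
        ⟨g.lt_symm_apply.2 h1, g.symm_apply_lt.2 h2⟩)
    refine ⟨k * k', G.mul_mem hkG hkG', fun t h1 h2 => ?_⟩
    have e1 := hk' t h1 h2
    have e2 := hk (g t) (g.monotone h1) (g.monotone h2)
    simp only [Function.comp_apply, Units.val_mul, Subring.coe_mul]
    linear_combination e2 + ((k : S) : ℝ) * e1

theorem PLSG.conj_mem {a b c d : S} (θ : Set.Icc (a : ℝ) b ≃o Set.Icc (c : ℝ) d)
    (hθ : IsPLMap S G θ) (hmem : ∀ t : Set.Icc (a : ℝ) b, (t : ℝ) ∈ S → (θ t : ℝ) ∈ S)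
    (f : PLSG S G a b) :
    (θ.toHomeomorph.symm.trans f.1).trans θ.toHomeomorph ∈ PLSG S G c d := by
  refine ⟨θ.strictMono.comp (f.2.1.comp θ.symm.strictMono), ?_⟩
  let fo : Set.Icc (a : ℝ) b ≃o Set.Icc (a : ℝ) b :=
    f.2.1.orderIsoOfRightInverse f.1 (f⁻¹).1 (PLSG.apply_inv_self f)
  have h1 : IsPLMap S G (θ ∘ fo) := IsPLMap.comp hθ f.2.2 fun t ht => PLSG.map_mem f⁻¹ t ht
  exact IsPLMap.comp h1 (hθ.symm hmem) hmem

/-- Conjugation by a piecewise linear map between two intervals that preserves `S` in both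
directions. -/
theorem PLSG.nonempty_mulEquiv_of_orderIso {a b c d : S}
    (θ : Set.Icc (a : ℝ) b ≃o Set.Icc (c : ℝ) d) (hθ : IsPLMap S G θ)
    (hmem : ∀ t : Set.Icc (a : ℝ) b, (t : ℝ) ∈ S → (θ t : ℝ) ∈ S)
    (hmem' : ∀ t : Set.Icc (c : ℝ) d, (t : ℝ) ∈ S → (θ.symm t : ℝ) ∈ S) :
    Nonempty (PLSG S G a b ≃* PLSG S G c d) :=
  ⟨{  toFun := fun f => ⟨_, PLSG.conj_mem θ hθ hmem f⟩
      invFun := fun f => ⟨_, PLSG.conj_mem θ.symm (hθ.symm hmem) hmem' f⟩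
      left_inv := fun f => PLSG.ext fun t => by
        change θ.symm (θ (f.1 (θ.symm (θ t)))) = f.1 t
        simp
      right_inv := fun f => PLSG.ext fun t => by
        change θ (θ.symm (f.1 (θ (θ.symm t)))) = f.1 t
        simp
      map_mul' := fun f g => PLSG.ext fun t => by
        change θ (f.1 (g.1 (θ.symm t))) = θ (f.1 (θ.symm (θ (g.1 (θ.symm t)))))
        simp }⟩

/-- The map of the line with `p ↦ q`, of slope `l` to the left of `p` and `r` to the right. -/
def twoSlope (p q l r t : ℝ) : ℝ := q + l * min (t - p) 0 + r * max (t - p) 0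

theorem twoSlope_of_le {p q l r t : ℝ} (h : t ≤ p) : twoSlope p q l r t = q + l * (t - p) := by
  rw [twoSlope, min_eq_left (by linarith), max_eq_right (by linarith), mul_zero, add_zero]

theorem twoSlope_of_ge {p q l r t : ℝ} (h : p ≤ t) : twoSlope p q l r t = q + r * (t - p) := by
  rw [twoSlope, min_eq_right (by linarith), max_eq_left (by linarith), mul_zero, add_zero]

theorem strictMono_twoSlope {p q l r : ℝ} (hl : 0 < l) (hr : 0 < r) :
    StrictMono (twoSlope p q l r) := by
  intro s t hst
  rcases le_total s p with hs | hs <;> rcases le_total t p with ht | ht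
  · rw [twoSlope_of_le hs, twoSlope_of_le ht]
    nlinarith
  · rw [twoSlope_of_le hs, twoSlope_of_ge ht]
    rcases eq_or_lt_of_le hs with h | h
    · rw [h, sub_self]
      nlinarith
    · nlinarith [mul_nonneg hr.le (sub_nonneg.2 ht), mul_pos hl (sub_pos.2 h)]
  · linarith
  · rw [twoSlope_of_ge hs, twoSlope_of_ge ht]
    nlinarith

theorem twoSlope_twoSlope {p q l r l' r' : ℝ} (hl : 0 < l) (hr : 0 < r) (hl' : l' * l = 1)
    (hr' : r' * r = 1) (t : ℝ) : twoSlope q p l' r' (twoSlope p q l r t) = t := by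
  rcases le_total t p with h | h
  · rw [twoSlope_of_le h, twoSlope_of_le (by nlinarith)]
    linear_combination (t - p) * hl'
  · rw [twoSlope_of_ge h, twoSlope_of_ge (by nlinarith)]
    linear_combination (t - p) * hr'

theorem twoSlope_mem {p q l r t : ℝ} (hp : p ∈ S) (hq : q ∈ S) (hl : l ∈ S) (hr : r ∈ S)
    (ht : t ∈ S) : twoSlope p q l r t ∈ S := by
  rcases le_total t p with h | h
  · rw [twoSlope_of_le h]
    exact S.add_mem hq (S.mul_mem hl (S.sub_mem ht hp))
  · rw [twoSlope_of_ge h]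
    exact S.add_mem hq (S.mul_mem hr (S.sub_mem ht hp))

theorem PLSG.nonempty_mulEquiv_of_twoSlope {a b c d : S} (p q : S) {l r : Sˣ} (hl : l ∈ G)
    (hr : r ∈ G) (hl0 : 0 < ((l : S) : ℝ)) (hr0 : 0 < ((r : S) : ℝ))
    (hc : twoSlope p q (l : S) (r : S) a = c) (hd : twoSlope p q (l : S) (r : S) b = d) :
    Nonempty (PLSG S G a b ≃* PLSG S G c d) := by
  have hll : (((l⁻¹ : Sˣ) : S) : ℝ) * ((l : S) : ℝ) = 1 :=
    congrArg (fun s : S => (s : ℝ)) (Units.inv_mul l)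
  have hrr : (((r⁻¹ : Sˣ) : S) : ℝ) * ((r : S) : ℝ) = 1 :=
    congrArg (fun s : S => (s : ℝ)) (Units.inv_mul r)
  have hl0' : 0 < (((l⁻¹ : Sˣ) : S) : ℝ) := pos_of_mul_pos_left (by rw [hll]; exact one_pos) hl0.le
  have hr0' : 0 < (((r⁻¹ : Sˣ) : S) : ℝ) := pos_of_mul_pos_left (by rw [hrr]; exact one_pos) hr0.le
  have hmono := strictMono_twoSlope (p := p) (q := q) hl0 hr0
  have hmono' := strictMono_twoSlope (p := q) (q := p) hl0' hr0'
  have hinv := twoSlope_twoSlope (p := p) (q := q) hl0 hr0 hll hrr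
  have hinv' := twoSlope_twoSlope (p := q) (q := p) hl0' hr0' ((mul_comm _ _).trans hll)
    ((mul_comm _ _).trans hrr)
  have hc' := hinv a
  have hd' := hinv b
  rw [hc] at hc'
  rw [hd] at hd'
  let F : Set.Icc (a : ℝ) b → Set.Icc (c : ℝ) d := fun t =>
    ⟨twoSlope p q (l : S) (r : S) t, hc ▸ hmono.monotone t.2.1, hd ▸ hmono.monotone t.2.2⟩
  let F' : Set.Icc (c : ℝ) d → Set.Icc (a : ℝ) b := fun t =>
    ⟨twoSlope q p ((l⁻¹ : Sˣ) : S) ((r⁻¹ : Sˣ) : S) t,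
      (hmono'.monotone t.2.1).trans_eq' hc', (hmono'.monotone t.2.2).trans_eq hd'⟩
  have hF : StrictMono F := fun s t hst => hmono hst
  let θ := hF.orderIsoOfRightInverse F F' fun t => Subtype.ext (hinv' t)
  refine PLSG.nonempty_mulEquiv_of_orderIso θ ⟨{(p : ℝ)}, ?_, ?_⟩
    (fun t ht => twoSlope_mem p.2 q.2 l.val.2 r.val.2 ht)
    (fun t ht => twoSlope_mem q.2 p.2 (l⁻¹).val.2 (r⁻¹).val.2 ht)
  · intro x hx
    rw [Finset.mem_singleton.1 hx]
    exact p.2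
  · intro u v huv hfree
    have huv' : (u : ℝ) < v := huv
    rcases le_or_gt (v : ℝ) p with hvp | hpv
    · refine ⟨l, hl, fun t h1 h2 => ?_⟩
      have h2' : (t : ℝ) ≤ v := h2
      change twoSlope p q (l : S) (r : S) t = twoSlope p q (l : S) (r : S) u + _
      rw [twoSlope_of_le (h2'.trans hvp), twoSlope_of_le (huv'.le.trans hvp)]
      ring
    · have hpu : (p : ℝ) ≤ u := le_of_not_gt fun h => hfree p (Finset.mem_singleton_self _) ⟨h, hpv⟩
      refine ⟨r, hr, fun t h1 h2 => ?_⟩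
      have h1' : (u : ℝ) ≤ t := h1
      change twoSlope p q (l : S) (r : S) t = twoSlope p q (l : S) (r : S) u + _
      rw [twoSlope_of_ge (hpu.trans h1'), twoSlope_of_ge hpu]
      ring

end Conjugation

section Dyadic

theorem dyadic_exists_natCast_mul {x : ℝ} (hx : x ∈ dyadic) :
    ∃ (n : ℕ) (k : ℤ), 2 ^ n * x = k := by
  induction hx using Subring.closure_induction with
  | mem x hx => exact ⟨1, 1, by rw [Set.mem_singleton_iff.1 hx]; norm_num⟩
  | zero => exact ⟨0, 0, by simp⟩
  | one => exact ⟨0, 1, by simp⟩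
  | add x y _ _ hx hy =>
    obtain ⟨n, k, h⟩ := hx
    obtain ⟨m, j, h'⟩ := hy
    refine ⟨n + m, 2 ^ m * k + 2 ^ n * j, ?_⟩
    push_cast
    rw [← h, ← h', pow_add]
    ring
  | neg x _ hx =>
    obtain ⟨n, k, h⟩ := hx
    exact ⟨n, -k, by push_cast; rw [← h]; ring⟩
  | mul x y _ _ hx hy =>
    obtain ⟨n, k, h⟩ := hx
    obtain ⟨m, j, h'⟩ := hy
    refine ⟨n + m, k * j, ?_⟩
    push_cast
    rw [← h, ← h', pow_add]
    ring

theorem coe_dyadicTwo_pow (n : ℕ) : (((dyadicTwo ^ n : dyadicˣ) : dyadic) : ℝ) = 2 ^ n := by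
  rw [Units.val_pow_eq_pow_val, Subring.coe_pow]
  rfl

theorem coe_dyadicTwo_inv : (((dyadicTwo⁻¹ : dyadicˣ) : dyadic) : ℝ) = 1 / 2 := rfl

/-- Halving the lengths of the last two unit intervals identifies `[0, k + 2]` with
`[0, k + 1]`. -/
theorem PL2_natCast_mulEquiv_thompsonF (k : ℕ) :
    ∀ b : dyadic, (b : ℝ) = k + 1 → Nonempty (PL2 0 b ≃* ThompsonF) := by
  induction k with
  | zero =>
    intro b hb
    have : b = 1 := Subtype.ext (by rw [hb]; simp)
    subst this
    exact ⟨MulEquiv.refl _⟩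
  | succ k ih =>
    intro b hb
    obtain ⟨e⟩ := ih (k + 1) (by simp)
    have hk : (0 : ℝ) ≤ k := Nat.cast_nonneg k
    obtain ⟨e'⟩ := PLSG.nonempty_mulEquiv_of_twoSlope (S := dyadic)
      (G := Subgroup.zpowers dyadicTwo) (a := 0) (b := b) (c := 0) (d := k + 1) k k
      (l := 1) (r := dyadicTwo⁻¹) (one_mem _) (inv_mem (Subgroup.mem_zpowers _))
      (by simp) (by rw [coe_dyadicTwo_inv]; norm_num)
      (by rw [twoSlope_of_le (by simp)]; simp)
      (by
        push_cast at hb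
        rw [twoSlope_of_ge (by simp only [Subring.coe_natCast]; linarith), coe_dyadicTwo_inv, hb]
        simp only [Subring.coe_natCast, Subring.coe_add, Subring.coe_one]
        ring)
    exact ⟨e'.trans e⟩

theorem PL2_mulEquiv_thompsonF {a b : dyadic} (hab : a < b) : Nonempty (PL2 a b ≃* ThompsonF) := by
  obtain ⟨n, k, hk⟩ := dyadic_exists_natCast_mul (b - a).2
  have hpos : (0 : ℝ) < k := by
    rw [← hk]
    exact mul_pos (by positivity) (sub_pos.2 (show (a : ℝ) < b from hab))
  obtain ⟨j, hj⟩ : ∃ j : ℕ, k = j + 1 := ⟨(k - 1).toNat, by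
    have : 0 < k := by exact_mod_cast hpos
    omega⟩
  obtain ⟨e⟩ := PL2_natCast_mulEquiv_thompsonF j (j + 1) (by simp)
  have hmem : dyadicTwo ^ n ∈ Subgroup.zpowers dyadicTwo := Subgroup.npow_mem_zpowers _ _
  have h0 : (0 : ℝ) < ((dyadicTwo ^ n : dyadicˣ) : dyadic) := by
    rw [coe_dyadicTwo_pow]; positivity
  obtain ⟨e'⟩ := PLSG.nonempty_mulEquiv_of_twoSlope (S := dyadic)
    (G := Subgroup.zpowers dyadicTwo) (a := a) (b := b) (c := 0) (d := j + 1) a 0 hmem hmem h0 h0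
    (by rw [twoSlope_of_le le_rfl]; simp)
    (by
      rw [twoSlope_of_ge (show (a : ℝ) ≤ b from hab.le), coe_dyadicTwo_pow]
      rw [hj] at hk
      push_cast at hk ⊢
      linarith)
  exact ⟨e'.trans e⟩

end Dyadic

/-! ### The decomposition along the cut points -/

section Decomposition

variable {S : Subring ℝ} {G : Subgroup Sˣ} {a b : S} {N : ℕ} {α : Fin (N + 1) → S}

theorem PLSG.exists_cutPoints_restrictions (hab : a < b) (z : PLSG S G a b) :
    ∃ (N : ℕ) (α : Fin (N + 1) → S) (y : ∀ i : Fin N, PLSG S G (α i.castSucc) (α i.succ)),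
      StrictMono α ∧ Set.range α = cutPoints z ∧ ∀ i, IsRestriction z (y i) := by
  obtain ⟨N, α, hα, hr⟩ := exists_enum_cutPoints z
  obtain ⟨y, hy⟩ := PLSG.exists_restrictions hab hα hr
  exact ⟨N, α, y, hα, hr, hy⟩

variable {z : PLSG S G a b} {y : ∀ i : Fin N, PLSG S G (α i.castSucc) (α i.succ)}

theorem centralizer_restriction_isInfiniteCyclicOnRoot (hab : a < b) (hα : StrictMono α)
    (hr : Set.range α = cutPoints z) (hy : ∀ i, IsRestriction z (y i)) (i : Fin N)
    (hi : y i ≠ 1) : IsInfiniteCyclicOnRoot (Subgroup.centralizer {y i}) (y i) :=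
  PLSG.isInfiniteCyclicOnRoot_centralizer (hα Fin.castSucc_lt_succ)
    (mem_PLSG0_of_ne_one hab hα hr hy hi) hi

/-- Each piece on which `z` is the identity, except possibly the last piece, is followed by one on
which it is not. -/
theorem card_restriction_eq_one_le (hab : a < b) (hα : StrictMono α)
    (hr : Set.range α = cutPoints z) (hy : ∀ i, IsRestriction z (y i)) :
    Nat.card {i : Fin N // y i = 1} ≤ Nat.card {i : Fin N // y i ≠ 1} + 1 := by
  classical
  -- the successor of an index with trivial restriction, unless that index is the last one
  let F : {i : Fin N // y i = 1} → Option {i : Fin N // y i ≠ 1} := fun i =>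
    if h : (i.1 : ℕ) + 1 < N then
      some ⟨⟨i.1 + 1, h⟩, restriction_ne_one_of_succ_eq hab hα hr hy (Fin.ext rfl) i.2⟩
    else none
  have hF : Function.Injective F := by
    intro i j hij
    have hi := i.1.2
    have hj := j.1.2
    refine Subtype.ext (Fin.ext ?_)
    by_cases h1 : (i.1 : ℕ) + 1 < N <;> by_cases h2 : (j.1 : ℕ) + 1 < N
    · simp only [F, dif_pos h1, dif_pos h2, Option.some.injEq, Subtype.mk.injEq, Fin.mk.injEq]
        at hij
      omega
    · simp [F, h1, h2] at hij
    · simp [F, h1, h2] at hij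
    · omega
  have h := Nat.card_le_card_of_injective F hF
  rwa [Finite.card_option] at h

end Decomposition

theorem mainTheorem10 :
    -- Thompson's group
    (∀ x : ThompsonF,
      ∃ (N : ℕ) (α : Fin (N + 1) → dyadic) (y : ∀ i : Fin N, PL2 (α i.castSucc) (α i.succ)),
        StrictMono α ∧ Set.range α = cutPoints x ∧
        (∀ i, IsRestriction x (y i)) ∧
        -- restriction is an isomorphism onto the product of the centralizers on the pieces
        (∃ φ : Subgroup.centralizer {x} ≃* (∀ i : Fin N, Subgroup.centralizer {y i}),
          ∀ g i, IsRestriction g.1 (φ g i).1) ∧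
        -- the centralizers on the pieces
        (∀ i, y i = 1 → Subgroup.centralizer {y i} = ⊤) ∧
        (∀ i, y i ≠ 1 → IsInfiniteCyclicOnRoot (Subgroup.centralizer {y i}) (y i)) ∧
        -- the structure of the whole centralizer
        (∃ m n : ℕ, m = Nat.card {i : Fin N // y i = 1} ∧ n = Nat.card {i : Fin N // y i ≠ 1} ∧
          m ≤ n + 1 ∧
          Nonempty (Subgroup.centralizer {x} ≃*
            (Fin m → ThompsonF) × (Fin n → Multiplicative ℤ)))) ∧
    -- the groups with breakpoints in `S` and slopes in `G`
    (∀ (S : Subring ℝ) (G : Subgroup Sˣ), (∀ c ∈ G, 0 < ((c : S) : ℝ)) →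
      ∀ a b : S, a < b →
        (∀ z ∈ PLSG0 S G a b, z ≠ 1 →
          Nonempty (Subgroup.centralizer {z} ≃* Multiplicative ℤ) ∧
          IsInfiniteCyclicOnRoot (Subgroup.centralizer {z}) z) ∧
        (∀ z : PLSG S G a b,
          ∃ (N : ℕ) (α : Fin (N + 1) → S)
            (y : ∀ i : Fin N, PLSG S G (α i.castSucc) (α i.succ)),
            StrictMono α ∧ Set.range α = cutPoints z ∧
            (∀ i, IsRestriction z (y i)) ∧
            (∃ φ : Subgroup.centralizer {z} ≃* (∀ i : Fin N, Subgroup.centralizer {y i}),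
              ∀ g i, IsRestriction g.1 (φ g i).1) ∧
            (∀ i, y i = 1 → Subgroup.centralizer {y i} = ⊤) ∧
            (∀ i, y i ≠ 1 → IsInfiniteCyclicOnRoot (Subgroup.centralizer {y i}) (y i)) ∧
            Nonempty (Subgroup.centralizer {z} ≃*
              (∀ i : {i : Fin N // y i = 1}, PLSG S G (α i.1.castSucc) (α i.1.succ)) ×
                ({i : Fin N // y i ≠ 1} → Multiplicative ℤ)))) := by
  refine ⟨fun x => ?_, fun S G _ a b hab => ⟨fun z hz hz1 => ?_, fun z => ?_⟩⟩
  · have hab : (0 : dyadic) < 1 := zero_lt_one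
    obtain ⟨N, α, y, hα, hr, hy⟩ := PLSG.exists_cutPoints_restrictions hab x
    have hcyc := centralizer_restriction_isInfiniteCyclicOnRoot hab hα hr hy
    obtain ⟨φ, hφ⟩ := (isPartition_of_range_eq_cutPoints hab hα hr).exists_centralizer_mulEquiv hab
      hy fun g hg => PLSG.apply_eq_of_commute hab hα hr hg
    obtain ⟨e⟩ := nonempty_pi_centralizer_mulEquiv y hcyc
    refine ⟨N, α, y, hα, hr, hy, ⟨φ, hφ⟩,
      fun i hi => Subgroup.centralizer_singleton_of_eq_one hi, hcyc, _, _, rfl, rfl,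
      card_restriction_eq_one_le hab hα hr hy, ?_⟩
    let e1 : (∀ i : {i : Fin N // y i = 1}, PL2 (α i.1.castSucc) (α i.1.succ)) ≃*
        ({i : Fin N // y i = 1} → ThompsonF) := MulEquiv.piCongrRight fun i =>
      (PL2_mulEquiv_thompsonF (hα Fin.castSucc_lt_succ)).some
    exact ⟨(φ.trans e).trans (MulEquiv.prodCongr
      (e1.trans (MulEquiv.arrowCongr (Finite.equivFin _) (MulEquiv.refl _)))
      (MulEquiv.arrowCongr (Finite.equivFin _) (MulEquiv.refl _)))⟩
  · have h := PLSG.isInfiniteCyclicOnRoot_centralizer hab hz hz1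
    exact ⟨h.nonempty_mulEquiv, h⟩
  · obtain ⟨N, α, y, hα, hr, hy⟩ := PLSG.exists_cutPoints_restrictions hab z
    have hcyc := centralizer_restriction_isInfiniteCyclicOnRoot hab hα hr hy
    obtain ⟨φ, hφ⟩ := (isPartition_of_range_eq_cutPoints hab hα hr).exists_centralizer_mulEquiv hab
      hy fun g hg => PLSG.apply_eq_of_commute hab hα hr hg
    obtain ⟨e⟩ := nonempty_pi_centralizer_mulEquiv y hcyc
    exact ⟨N, α, y, hα, hr, hy, ⟨φ, hφ⟩,
      fun i hi => Subgroup.centralizer_singleton_of_eq_one hi, hcyc, ⟨φ.trans e⟩⟩
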